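/- Let $G$ be a locally compact (Hausdorff) group with left Haar measure, and let $L^1(G)$ be its group algebra, that is, the Banach algebra of complex integrable functions on $G$ (modulo equality almost everywhere) with the convolution product $(f*g)(x)=\int_G f(y)\,g(y^{-1}x)\,dy$. Then $L^1(G)$ is symmetrically pseudo-amenable if and only if $G$ is amenable. Here a complex Banach algebra $A$ is called \emph{symmetrically pseudo-amenable} if there is a (not necessarily bounded) net $(t_\lambda)_{\lambda\in\Lambda}$ in the projective tensor product $A\widehat{\otimes}A$ such that $t_\lambda^{\circ}=t_\lambda$ for all $\lambda$, and, for all $a\in A$, $a\,t_\lambda-t_\lambda\,a\to 0$ and $\pi(t_\lambda)\,a\to a$ in norm, where the flip $t\mapsto t^\circ$, the module actions and $\pi$ are the continuous linear maps determined by $(b\otimes c)^{\circ}=c\otimes b$, $a(b\otimes c)=ab\otimes c$, $(b\otimes c)a=b\otimes ca$ and $\pi(b\otimes c)=bc$. The group $G$ is called \emph{amenable} if there is a left invariant mean on $L^\infty(G)$, that is, a positive linear functional $m$ on $L^\infty(G)$ with $m(1)=1$ and $m(L_xf)=m(f)$ for all $x\in G$ and $f\in L^\infty(G)$, where $(L_xf)(y)=f(x^{-1}y)$.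 -/

import Mathlib

open MeasureTheory Filter Topology
open scoped ENNReal TensorProduct

noncomputable section

/-! ### The projective tensor square of a Banach algebra -/

section ProjectiveTensor

variable (A : Type*) [NonUnitalNormedRing A] [NormedSpace ℂ A]

/-- The projective tensor product `A ⊗̂ A`: the completion of the algebraic tensor product
`A ⊗ A` over `ℂ` with respect to the projective norm
`‖t‖ = inf {∑ ‖aᵢ‖ ‖bᵢ‖ : t = ∑ aᵢ ⊗ bᵢ}`, which is Mathlib's norm on `⨂[ℂ] i, E i`. -/
abbrev ProjTensorSq : Type _ := UniformSpace.Completion (⨂[ℂ] _ : Fin 2, A)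

variable {A}

/-- The elementary tensor `a ⊗ b` in `A ⊗̂ A`. -/
def ProjTensorSq.tmul (a b : A) : ProjTensorSq A :=
  ((PiTensorProduct.tprod ℂ (![a, b] : Fin 2 → A) : ⨂[ℂ] _ : Fin 2, A) : ProjTensorSq A)

/-- The flip map `t ↦ t°` of `A ⊗̂ A`, the continuous linear map with `(a ⊗ b)° = b ⊗ a`. -/
def ProjTensorSq.flip : ProjTensorSq A →L[ℂ] ProjTensorSq A :=
  (PiTensorProduct.liftIsometry ℂ (fun _ : Fin 2 => A) (⨂[ℂ] _ : Fin 2, A)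
    ((PiTensorProduct.tprodL ℂ).domDomCongr (Equiv.swap (0 : Fin 2) 1))).completion

theorem ProjTensorSq.flip_tmul (a b : A) :
    ProjTensorSq.flip (ProjTensorSq.tmul a b) = ProjTensorSq.tmul b a := by
  have h : (fun i => (![a, b] : Fin 2 → A) (Equiv.swap (0 : Fin 2) 1 i)) = ![b, a] := by
    funext i; fin_cases i <;> simp
  simp only [ProjTensorSq.flip, ProjTensorSq.tmul, ContinuousLinearMap.completion_apply_coe]
  congr 1
  simp [h]

variable [IsScalarTower ℂ A A] [SMulCommClass ℂ A A]

/-- The left action on `A ⊗̂ A`, the continuous linear map with `a (b ⊗ c) = ab ⊗ c`. -/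
def ProjTensorSq.leftMul (a : A) : ProjTensorSq A →L[ℂ] ProjTensorSq A :=
  (PiTensorProduct.mapL
    (![ContinuousLinearMap.mul ℂ A a, ContinuousLinearMap.id ℂ A] :
      Fin 2 → (A →L[ℂ] A))).completion

theorem ProjTensorSq.leftMul_tmul (a b c : A) :
    ProjTensorSq.leftMul a (ProjTensorSq.tmul b c) = ProjTensorSq.tmul (a * b) c := by
  simp only [ProjTensorSq.leftMul, ProjTensorSq.tmul, ContinuousLinearMap.completion_apply_coe]
  congr 1
  simp only [PiTensorProduct.mapL_apply, PiTensorProduct.map_tprod]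
  congr 1
  funext i; fin_cases i <;> simp

/-- The right action on `A ⊗̂ A`, the continuous linear map with `(b ⊗ c) a = b ⊗ ca`. -/
def ProjTensorSq.rightMul (a : A) : ProjTensorSq A →L[ℂ] ProjTensorSq A :=
  (PiTensorProduct.mapL
    (![ContinuousLinearMap.id ℂ A, (ContinuousLinearMap.mul ℂ A).flip a] :
      Fin 2 → (A →L[ℂ] A))).completion

theorem ProjTensorSq.rightMul_tmul (a b c : A) :
    ProjTensorSq.rightMul a (ProjTensorSq.tmul b c) = ProjTensorSq.tmul b (c * a) := by
  simp only [ProjTensorSq.rightMul, ProjTensorSq.tmul, ContinuousLinearMap.completion_apply_coe]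
  congr 1
  simp only [PiTensorProduct.mapL_apply, PiTensorProduct.map_tprod]
  congr 1
  funext i; fin_cases i <;> simp

variable (A) in
/-- The product of `A` as a continuous multilinear map `(m₀, m₁) ↦ m₀ m₁`. -/
def mulMultilinear : ContinuousMultilinearMap ℂ (fun _ : Fin 2 => A) A :=
  MultilinearMap.mkContinuous
    { toFun := fun m => m 0 * m 1
      map_update_add' := by
        intro _ m i x y
        fin_cases i <;> simp [Function.update, add_mul, mul_add]
      map_update_smul' := by
        intro _ m i c x
        fin_cases i <;> simp [Function.update, smul_mul_assoc, mul_smul_comm] }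
    1 (fun m => by simpa using norm_mul_le (m 0) (m 1))

/-- The product morphism `π : A ⊗̂ A → A`, the continuous linear map with `π (a ⊗ b) = ab`. -/
def ProjTensorSq.prod [CompleteSpace A] : ProjTensorSq A →L[ℂ] A :=
  (PiTensorProduct.liftIsometry ℂ (fun _ : Fin 2 => A) A (mulMultilinear A)).fromCompletion

theorem ProjTensorSq.prod_tmul [CompleteSpace A] (a b : A) :
    ProjTensorSq.prod (ProjTensorSq.tmul a b) = a * b := by
  simp [ProjTensorSq.prod, ProjTensorSq.tmul, mulMultilinear]

end ProjectiveTensor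

/-! ### Symmetric pseudo-amenability -/

section PseudoAmenable

variable {A : Type*} [NonUnitalNormedRing A] [NormedSpace ℂ A] [IsScalarTower ℂ A A]
  [SMulCommClass ℂ A A] [CompleteSpace A]

/-- A net `t` in `A ⊗̂ A` is an approximate diagonal if `a t_λ - t_λ a → 0` and
`π(t_λ) a → a` for all `a`. No boundedness is required. -/
def IsApproximateDiagonal {Λ : Type*} [Preorder Λ] (t : Λ → ProjTensorSq A) : Prop :=
  ∀ a : A,
    Tendsto (fun i => ProjTensorSq.leftMul a (t i) - ProjTensorSq.rightMul a (t i)) atTop (𝓝 0) ∧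
    Tendsto (fun i => ProjTensorSq.prod (t i) * a) atTop (𝓝 a)

/-- A Banach algebra is symmetrically pseudo-amenable if it has an approximate diagonal (a net
over a nonempty directed set) consisting of symmetric elements. -/
def IsSymmetricallyPseudoAmenable.{u} (A : Type u) [NonUnitalNormedRing A] [NormedSpace ℂ A]
    [IsScalarTower ℂ A A] [SMulCommClass ℂ A A] [CompleteSpace A] : Prop :=
  ∃ (Λ : Type u) (_ : Preorder Λ) (_ : Nonempty Λ) (_ : IsDirected Λ (· ≤ ·))
    (t : Λ → ProjTensorSq A),
    IsApproximateDiagonal t ∧ ∀ i, ProjTensorSq.flip (t i) = t i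

end PseudoAmenable

/-! ### The group algebra `L¹(G)` -/

section GroupAlgebra

set_option linter.unusedSectionVars false

variable {G : Type*} [Group G] [TopologicalSpace G] [IsTopologicalGroup G]
  [MeasurableSpace G] [BorelSpace G] {μ : Measure G}

/-- Left translation on `L¹(G)`: `(L_y g)(x) = g (y⁻¹ x)`. -/
def leftTranslate [μ.IsMulLeftInvariant] (y : G) (g : Lp ℂ 1 μ) : Lp ℂ 1 μ :=
  Lp.compMeasurePreserving (fun x => y⁻¹ * x) (measurePreserving_mul_left μ y⁻¹) g

/-- Convolution on `L¹(G)`, `(f * g)(x) = ∫ f(y) g(y⁻¹ x) dy`, as the `L¹(G)`-valued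
Bochner integral `f * g = ∫ f(y) • L_y g dy`. -/
def l1Conv [μ.IsMulLeftInvariant] (f g : Lp ℂ 1 μ) : Lp ℂ 1 μ :=
  ∫ y, (f y) • leftTranslate y g ∂μ

section Translate

variable [μ.IsMulLeftInvariant]

theorem norm_leftTranslate (y : G) (g : Lp ℂ 1 μ) : ‖leftTranslate y g‖ = ‖g‖ :=
  Lp.norm_compMeasurePreserving g _

theorem leftTranslate_add (y : G) (g h : Lp ℂ 1 μ) :
    leftTranslate y (g + h) = leftTranslate y g + leftTranslate y h :=
  map_add _ _ _

theorem leftTranslate_smul (y : G) (c : ℂ) (g : Lp ℂ 1 μ) :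
    leftTranslate y (c • g) = c • leftTranslate y g :=
  (Lp.compMeasurePreservingₗ ℂ _ (measurePreserving_mul_left μ y⁻¹)).map_smul c g

theorem leftTranslate_mul (y z : G) (g : Lp ℂ 1 μ) :
    leftTranslate (y * z) g = leftTranslate y (leftTranslate z g) := by
  have h := mul_smul (DomMulAct.mk y⁻¹) (DomMulAct.mk z⁻¹) g
  rw [← DomMulAct.mk_mul, ← mul_inv_rev] at h
  exact h

variable (μ) in
/-- Left translation as a continuous linear map. -/
def leftTranslateL (y : G) : Lp ℂ 1 μ →L[ℂ] Lp ℂ 1 μ :=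
  (Lp.compMeasurePreservingₗᵢ ℂ _ (measurePreserving_mul_left μ y⁻¹)).toContinuousLinearMap

theorem leftTranslateL_apply (y : G) (g : Lp ℂ 1 μ) :
    leftTranslateL μ y g = leftTranslate y g := rfl

theorem coeFn_leftTranslate (y : G) (g : Lp ℂ 1 μ) :
    leftTranslate y g =ᵐ[μ] fun x => g (y⁻¹ * x) :=
  Lp.coeFn_compMeasurePreserving g _

end Translate

variable [LocallyCompactSpace G] [T2Space G] [μ.IsHaarMeasure] [μ.Regular]

theorem continuous_leftTranslate (g : Lp ℂ 1 μ) : Continuous fun y : G => leftTranslate y g := by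
  have : Fact ((1 : ℝ≥0∞) ≠ ∞) := ⟨ENNReal.one_ne_top⟩
  have h : Continuous fun y : G => DomMulAct.mk y⁻¹ • g :=
    (DomMulAct.continuous_mk.comp continuous_inv).smul continuous_const
  exact h

theorem aestronglyMeasurable_restrict_of_continuous {E : Type*} [NormedAddCommGroup E]
    {φ : G → E} (hφ : Continuous φ) {s : Set G} (hs : MeasurableSet s) (hμs : μ s ≠ ∞) :
    AEStronglyMeasurable φ (μ.restrict s) := by
  have hK : ∀ n : ℕ, ∃ K ⊆ s, IsCompact K ∧ μ (s \ K) < ((n : ℝ≥0∞) + 1)⁻¹ := fun n =>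
    hs.exists_isCompact_sdiff_lt hμs (by simp)
  choose K hK1 hK2 hK3 using hK
  have hT : AEStronglyMeasurable φ (μ.restrict (⋃ n, K n)) :=
    aestronglyMeasurable_iUnion_iff.2 fun n =>
      hφ.continuousOn.aestronglyMeasurable_of_isCompact (hK2 n) (hK2 n).measurableSet
  have h0 : Tendsto (fun n : ℕ => ((n : ℝ≥0∞) + 1)⁻¹) atTop (𝓝 0) := by
    have := (tendsto_add_atTop_iff_nat 1).2 ENNReal.tendsto_inv_nat_nhds_zero
    simpa using this
  have hN : AEStronglyMeasurable φ (μ.restrict (s \ ⋃ n, K n)) := by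
    have hz : μ (s \ ⋃ n, K n) = 0 := by
      refine le_antisymm (ge_of_tendsto' h0 fun n => ?_) zero_le
      exact (measure_mono (Set.sdiff_subset_sdiff_right (Set.subset_iUnion K n))).trans (hK3 n).le
    rw [Measure.restrict_eq_zero.2 hz]
    exact aestronglyMeasurable_zero_measure φ
  refine (aestronglyMeasurable_union_iff.2 ⟨hT, hN⟩).mono_measure
    (Measure.restrict_mono ?_ le_rfl)
  intro x hx
  by_cases h : x ∈ ⋃ n, K n
  · exact Or.inl h
  · exact Or.inr ⟨hx, h⟩

theorem integrable_smul_leftTranslate (f g : Lp ℂ 1 μ) :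
    Integrable (fun y => (f y) • leftTranslate y g) μ := by
  have hf : Integrable f μ := L1.integrable_coeFn f
  have hc := continuous_leftTranslate g
  have hfin := hf.aefinStronglyMeasurable
  have ht := hfin.measurableSet
  have hzero := hfin.ae_eq_zero_compl
  have hsf := hfin.sigmaFinite_restrict
  generalize hfin.sigmaFiniteSet = t at ht hzero hsf
  have h1 : AEStronglyMeasurable (fun y => leftTranslate y g) (μ.restrict t) := by
    have hcov : t = ⋃ n, spanningSets (μ.restrict t) n ∩ t := by
      rw [← Set.iUnion_inter, iUnion_spanningSets, Set.univ_inter]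
    rw [hcov]
    refine aestronglyMeasurable_iUnion_iff.2 fun n => ?_
    have hm := measurableSet_spanningSets (μ.restrict t) n
    refine aestronglyMeasurable_restrict_of_continuous hc (hm.inter ht) ?_
    rw [← Measure.restrict_apply hm]
    exact (measure_spanningSets_lt_top (μ.restrict t) n).ne
  have hmeas : AEStronglyMeasurable (fun y => (f y) • leftTranslate y g) μ := by
    suffices h : AEStronglyMeasurable (fun y => (f y) • leftTranslate y g)
        (μ.restrict (t ∪ tᶜ)) by
      rwa [Set.union_compl_self, Measure.restrict_univ] at h
    refine aestronglyMeasurable_union_iff.2 ⟨hf.1.restrict.smul h1, ?_⟩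
    refine (aestronglyMeasurable_zero (β := Lp ℂ 1 μ)).congr ?_
    filter_upwards [hzero] with y hy
    simp [hy]
  refine (hf.norm.mul_const ‖g‖).mono' hmeas (ae_of_all _ fun y => ?_)
  rw [norm_smul, norm_leftTranslate]

theorem norm_conv_le (f g : Lp ℂ 1 μ) : ‖l1Conv f g‖ ≤ ‖f‖ * ‖g‖ := by
  refine (norm_integral_le_integral_norm _).trans_eq ?_
  simp_rw [norm_smul, norm_leftTranslate]
  rw [integral_mul_const, L1.norm_eq_integral_norm f]

theorem add_conv (f₁ f₂ g : Lp ℂ 1 μ) : l1Conv (f₁ + f₂) g = l1Conv f₁ g + l1Conv f₂ g := by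
  unfold l1Conv
  rw [← integral_add (integrable_smul_leftTranslate f₁ g) (integrable_smul_leftTranslate f₂ g)]
  refine integral_congr_ae ?_
  filter_upwards [Lp.coeFn_add f₁ f₂] with y hy
  rw [hy, Pi.add_apply, add_smul]

theorem conv_add (f g₁ g₂ : Lp ℂ 1 μ) : l1Conv f (g₁ + g₂) = l1Conv f g₁ + l1Conv f g₂ := by
  unfold l1Conv
  rw [← integral_add (integrable_smul_leftTranslate f g₁) (integrable_smul_leftTranslate f g₂)]
  simp_rw [leftTranslate_add, smul_add]

theorem smul_conv (c : ℂ) (f g : Lp ℂ 1 μ) : l1Conv (c • f) g = c • l1Conv f g := by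
  unfold l1Conv
  rw [← integral_smul]
  refine integral_congr_ae ?_
  filter_upwards [Lp.coeFn_smul c f] with y hy
  rw [hy, Pi.smul_apply, smul_assoc]

theorem conv_smul (c : ℂ) (f g : Lp ℂ 1 μ) : l1Conv f (c • g) = c • l1Conv f g := by
  unfold l1Conv
  rw [← integral_smul]
  simp_rw [leftTranslate_smul, smul_comm c]

theorem conv_leftTranslate (y : G) (f g : Lp ℂ 1 μ) :
    l1Conv (leftTranslate y f) g = leftTranslate y (l1Conv f g) := by
  unfold l1Conv
  rw [← leftTranslateL_apply y (∫ z, f z • leftTranslate z g ∂μ),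
    ← ContinuousLinearMap.integral_comp_comm _
    (integrable_smul_leftTranslate f g),
    ← integral_mul_left_eq_self (fun x => (leftTranslate y f) x • leftTranslate x g) y]
  refine integral_congr_ae ?_
  have h := (measurePreserving_mul_left μ y).quasiMeasurePreserving.ae (coeFn_leftTranslate y f)
  filter_upwards [h] with x hx
  rw [hx, map_smul, leftTranslateL_apply, leftTranslate_mul, inv_mul_cancel_left]

/-- Right convolution by `h` as a continuous linear map. -/
def convRightL (h : Lp ℂ 1 μ) : Lp ℂ 1 μ →L[ℂ] Lp ℂ 1 μ :=
  LinearMap.mkContinuous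
    { toFun := fun f => l1Conv f h
      map_add' := fun f₁ f₂ => add_conv f₁ f₂ h
      map_smul' := fun c f => smul_conv c f h } ‖h‖
    (fun f => (norm_conv_le f h).trans_eq (mul_comm _ _))

theorem conv_assoc (f g h : Lp ℂ 1 μ) : l1Conv (l1Conv f g) h = l1Conv f (l1Conv g h) := by
  change convRightL h (∫ y, (f y) • leftTranslate y g ∂μ) = _
  rw [← ContinuousLinearMap.integral_comp_comm _ (integrable_smul_leftTranslate f g)]
  refine integral_congr_ae (ae_of_all _ fun y => ?_)
  change convRightL h (f y • leftTranslate y g) = f y • leftTranslate y (l1Conv g h)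
  rw [map_smul, ← conv_leftTranslate]
  rfl

end GroupAlgebra

/-- The underlying Banach space of the group algebra `L¹(G)` of a locally compact group `G` with
left Haar measure `μ`: complex integrable functions modulo equality almost everywhere. Below it
is given the convolution product. -/
def GroupL1 (G : Type*) [MeasurableSpace G] (μ : Measure G) : Type _ := Lp ℂ 1 μ

namespace GroupL1

variable {G : Type*} [MeasurableSpace G] {μ : Measure G}

instance : NormedAddCommGroup (GroupL1 G μ) := inferInstanceAs (NormedAddCommGroup (Lp ℂ 1 μ))

instance : NormedSpace ℂ (GroupL1 G μ) := inferInstanceAs (NormedSpace ℂ (Lp ℂ 1 μ))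

instance : CompleteSpace (GroupL1 G μ) := inferInstanceAs (CompleteSpace (Lp ℂ 1 μ))

variable [Group G] [TopologicalSpace G] [IsTopologicalGroup G] [BorelSpace G]
  [LocallyCompactSpace G] [T2Space G] [μ.IsHaarMeasure] [μ.Regular]

instance : NonUnitalNormedRing (GroupL1 G μ) :=
  { (inferInstance : NormedAddCommGroup (GroupL1 G μ)) with
    mul := fun f g => l1Conv (μ := μ) f g
    left_distrib := fun f g h => conv_add (μ := μ) f g h
    right_distrib := fun f g h => add_conv (μ := μ) f g h
    zero_mul := fun f => by
      have h := smul_conv (μ := μ) 0 0 f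
      simp only [zero_smul] at h
      exact h
    mul_zero := fun f => by
      have h := conv_smul (μ := μ) 0 f 0
      simp only [zero_smul] at h
      exact h
    mul_assoc := fun f g h => conv_assoc (μ := μ) f g h
    norm_mul_le := fun f g => norm_conv_le (μ := μ) f g }

instance : IsScalarTower ℂ (GroupL1 G μ) (GroupL1 G μ) :=
  ⟨fun c f g => smul_conv (μ := μ) c f g⟩

instance : SMulCommClass ℂ (GroupL1 G μ) (GroupL1 G μ) :=
  ⟨fun c f g => (conv_smul (μ := μ) c f g).symm⟩

end GroupL1

/-! ### Amenable locally compact groups -/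

section AmenableGroup

variable {G : Type*} [TopologicalSpace G] [MeasurableSpace G]

/-- The real functions on `G` that represent elements of `L^∞(G)`: those that are locally
measurable (measurable on every compact set) and locally essentially bounded by a constant.
`L^∞(G)` is the quotient of this space by the locally null functions. -/
def LInftyFun (μ : Measure G) : Submodule ℝ (G → ℝ) where
  carrier := {f | (∀ K : Set G, IsCompact K → AEMeasurable f (μ.restrict K)) ∧
    ∃ C : ℝ, ∀ K : Set G, IsCompact K → ∀ᵐ x ∂(μ.restrict K), |f x| ≤ C}
  add_mem' := by
    rintro f g ⟨hf, C, hC⟩ ⟨hg, D, hD⟩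
    refine ⟨fun K hK => (hf K hK).add (hg K hK), C + D, fun K hK => ?_⟩
    filter_upwards [hC K hK, hD K hK] with x h1 h2
    exact (abs_add_le _ _).trans (add_le_add h1 h2)
  zero_mem' := ⟨fun _ _ => aemeasurable_const, 0, fun _ _ => ae_of_all _ fun _ => by simp⟩
  smul_mem' := by
    rintro c f ⟨hf, C, hC⟩
    refine ⟨fun K hK => (hf K hK).const_smul c, |c| * C, fun K hK => ?_⟩
    filter_upwards [hC K hK] with x h1
    simpa [abs_mul] using mul_le_mul_of_nonneg_left h1 (abs_nonneg c)

/-- The constant function `1` as an element of `LInftyFun μ`. -/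
def LInftyFun.one (μ : Measure G) : LInftyFun μ :=
  ⟨fun _ => 1, fun _ _ => aemeasurable_const, 1, fun _ _ => ae_of_all _ fun _ => by simp⟩

variable [Group G] [IsTopologicalGroup G] [BorelSpace G]

/-- Left translation `(L_x f)(y) = f (x⁻¹ y)` on `LInftyFun μ`. -/
def LInftyFun.translate {μ : Measure G} [μ.IsMulLeftInvariant] (x : G) (f : LInftyFun μ) :
    LInftyFun μ :=
  ⟨fun y => f.1 (x⁻¹ * y), by
    have key : ∀ K : Set G, IsCompact K → IsCompact ((fun y => x⁻¹ * y) '' K) ∧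
        MeasurePreserving (fun y => x⁻¹ * y) (μ.restrict K)
          (μ.restrict ((fun y => x⁻¹ * y) '' K)) := by
      intro K hK
      refine ⟨hK.image (continuous_const_mul x⁻¹), ?_⟩
      exact (measurePreserving_mul_left μ x⁻¹).restrict_image_emb
        (measurableEmbedding_mulLeft x⁻¹) K
    obtain ⟨hf, C, hC⟩ := f.2
    refine ⟨fun K hK => ?_, C, fun K hK => ?_⟩
    · exact (hf _ (key K hK).1).comp_quasiMeasurePreserving (key K hK).2.quasiMeasurePreserving
    · exact (key K hK).2.quasiMeasurePreserving.ae (hC _ (key K hK).1)⟩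

/-- A locally compact group `G` (with left Haar measure `μ`) is amenable if there is a left
invariant mean on `L^∞(G)`: a linear functional `m` with `m 1 = 1`, with `m f ≥ 0` whenever
`f ≥ 0` locally almost everywhere, and with `m (L_x f) = m f`. Positivity makes `m` vanish on
locally null functions, so that it is a functional on the quotient `L^∞(G)`, and makes it
bounded of norm `1`. -/
def IsAmenableGroup (G : Type*) [Group G] [TopologicalSpace G] [IsTopologicalGroup G]
    [MeasurableSpace G] [BorelSpace G] (μ : Measure G) [μ.IsMulLeftInvariant] : Prop :=
  ∃ m : LInftyFun μ →ₗ[ℝ] ℝ,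
    m (LInftyFun.one μ) = 1 ∧
    (∀ f : LInftyFun μ,
      (∀ K : Set G, IsCompact K → ∀ᵐ x ∂(μ.restrict K), 0 ≤ f.1 x) → 0 ≤ m f) ∧
    ∀ (x : G) (f : LInftyFun μ), m (LInftyFun.translate x f) = m f

end AmenableGroup

end

/-! Write `δ_z * a` and `a * δ_w` for left and right translates in `L¹(G)`, and `χ(a) = ∫ a` for the
augmentation character.

From amenability to symmetric tensors. Suppose `b * g` could not be made small, with `‖g‖ ≤ 1` and
`χ(g) = 1`, simultaneously for finitely many `b` of integral zero. Hahn–Banach would give a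
functional with real part at least `c > 0` on all such tuples, hence a function on `G` bounded below
by `c`. That function is a sum of coefficient functions `x ↦ Re ψ(a * L_x e)` with `χ(a) = 0`, which
an invariant mean annihilates (`mean_coefficient_eq_zero`), a contradiction. So `g` exists
(`IsAmenableGroup.exists_norm_conv_lt`), and `f = e * g` is almost left invariant because `L_w f - f
= (L_w e - e) * g`.

The tensor is `t = ∬ f(z) f(y) (δ_z * u * δ_{y⁻¹}) ⊗ (δ_y * u * δ_{z⁻¹}) dy dz`, an average of `u ⊗
u` over an outer and an inner action of `G`. The flip exchanges the two actions and they commute, so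
`t` is symmetric. Moving a translation by `w` across the outer average replaces `f` by `L_w f`, so
almost invariance of `f` controls `a t - t a`. The inner action leaves `π` unchanged and the outer
one conjugates it, so `π(t) a - a` is an average over `z` of `δ_z * (u² * x - x)` with `x = δ_{z⁻¹}
* a`. It is small once `u` is chosen, after `f`, as an approximate unit for these translates.

Conversely, slicing an approximate diagonal by `χ` in the second factor gives `f_i` with `a * f_i -
χ(a) f_i → 0` and `χ(f_i) = χ(π(t_i)) → 1`. These are asymptotically left invariant and bounded away
from zero, and an ultrafilter limit of the densities `|f_i| / ‖f_i‖` is an invariant mean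
(`isAmenableGroup_of_tendsto`). Symmetry plays no role in this direction. -/

noncomputable section

/-! ### Density of `C_c`, locally bounded functions, and integrated operators -/

section Integration

variable {G : Type*} [TopologicalSpace G] [MeasurableSpace G] [BorelSpace G] [T2Space G]
  [LocallyCompactSpace G] {μ : Measure G} [μ.Regular]

/-- Compactly supported continuous functions are dense in `L¹`, for a regular measure on a locally
compact Hausdorff space that need not be normal. -/
theorem exists_continuous_hasCompactSupport_integral_sub_le {F : Type*} [NormedAddCommGroup F]
    [NormedSpace ℝ F] {f : G → F} (hf : Integrable f μ) {ε : ℝ} (hε : 0 < ε) :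
    ∃ g : G → F, HasCompactSupport g ∧ (∫ x, ‖f x - g x‖ ∂μ) ≤ ε ∧ Continuous g := by
  have hind : ∀ (c : F) ⦃t : Set G⦄, MeasurableSet t → μ t < ∞ → ∀ {ε : ℝ≥0∞}, ε ≠ 0 →
      ∃ g : G → F, eLpNorm (g - t.indicator fun _ => c) 1 μ ≤ ε ∧
        (Continuous g ∧ HasCompactSupport g) := by
    intro c t ht htμ ε hε
    obtain ⟨η, hη, hηc⟩ := exists_eLpNorm_indicator_le (μ := μ) ENNReal.one_ne_top c hε
    have hη2 : (η : ℝ≥0∞) / 2 ≠ 0 := by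
      simpa using hη.ne'
    -- Squeeze `t` between a compact `s` and an open `V`. A Urysohn function that is `1` on `s` and
    -- `0` off `V` differs from the indicator of `t` only on `V \ s`, of measure at most `η`.
    obtain ⟨s, hst, hs, hμs⟩ := ht.exists_isCompact_sdiff_lt htμ.ne hη2
    obtain ⟨V, htV, hV, -, hμV⟩ := ht.exists_isOpen_sdiff_lt htμ.ne hη2
    obtain ⟨g, hg1, hg0, hgc, hg01⟩ := exists_continuous_one_zero_of_isCompact hs hV.isClosed_compl
      (Set.disjoint_compl_right_iff_subset.2 (hst.trans htV))
    refine ⟨fun x => g x • c, ?_, by fun_prop, hgc.smul_right⟩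
    refine (eLpNorm_mono (g := (V \ s).indicator fun _ => c) fun x => ?_).trans (hηc (V \ s) ?_)
    · by_cases hxs : x ∈ s
      · simp [hxs, hst hxs, hg1 hxs]
      by_cases hxV : x ∈ V
      · rw [Set.indicator_of_mem (show x ∈ V \ s from ⟨hxV, hxs⟩)]
        have h01 := hg01 x
        by_cases hxt : x ∈ t
        · have : g x • c - c = (g x - 1) • c := by rw [sub_smul, one_smul]
          simp only [Pi.sub_apply, Set.indicator_of_mem hxt, this, norm_smul, Real.norm_eq_abs]
          exact mul_le_of_le_one_left (norm_nonneg _)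
            (abs_le.2 ⟨by linarith [h01.1], by linarith [h01.2]⟩)
        · simp only [Pi.sub_apply, Set.indicator_of_notMem hxt, sub_zero, norm_smul,
            Real.norm_eq_abs]
          exact mul_le_of_le_one_left (norm_nonneg _) (abs_le.2 ⟨by linarith [h01.1], h01.2⟩)
      · have hxt : x ∉ t := fun h => hxV (htV h)
        simp [hxt, hg0 (show x ∈ Vᶜ from hxV)]
    · calc μ (V \ s) ≤ μ (V \ t ∪ t \ s) := measure_mono fun x hx => by
            by_cases hxt : x ∈ t
            · exact Or.inr ⟨hxt, hx.2⟩
            · exact Or.inl ⟨hx.1, hxt⟩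
        _ ≤ η / 2 + η / 2 := (measure_union_le _ _).trans (add_le_add hμV.le hμs.le)
        _ = η := ENNReal.add_halves _
  obtain ⟨g, hfg, hg, hgs⟩ := (memLp_one_iff_integrable.2 hf).induction_dense ENNReal.one_ne_top
    (fun g => Continuous g ∧ HasCompactSupport g) hind
    (fun f g hf hg => ⟨hf.1.add hg.1, HasCompactSupport.add hf.2 hg.2⟩)
    (fun f hf => (hf.1.integrable_of_hasCompactSupport (μ := μ) hf.2).aestronglyMeasurable)
    (ENNReal.ofReal_pos.2 hε).ne'
  refine ⟨g, hgs, ?_, hg⟩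
  rw [eLpNorm_one_eq_lintegral_enorm] at hfg
  change ∫ x, ‖(f - g) x‖ ∂μ ≤ ε
  rw [integral_norm_eq_lintegral_enorm
    (hf.sub (hg.integrable_of_hasCompactSupport hgs)).aestronglyMeasurable]
  exact ENNReal.toReal_le_of_le_ofReal hε.le hfg

/-- An integrable function vanishes almost everywhere outside a countable union of compact sets. -/
theorem exists_isCompact_seq_ae_eq_zero {F : Type*} [NormedAddCommGroup F] [NormedSpace ℝ F]
    {f : G → F} (hf : Integrable f μ) :
    ∃ K : ℕ → Set G, (∀ n, IsCompact (K n)) ∧ ∀ᵐ x ∂(μ.restrict (⋃ n, K n)ᶜ), f x = 0 := by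
  have h : ∀ n : ℕ, ∃ K : Set G, IsCompact K ∧ ∫ x in Kᶜ, ‖f x‖ ∂μ ≤ 1 / ((n : ℝ) + 1) := by
    intro n
    obtain ⟨g, hg, hfg, hgc⟩ := exists_continuous_hasCompactSupport_integral_sub_le hf
      (ε := 1 / ((n : ℝ) + 1)) (by positivity)
    have hgi := hgc.integrable_of_hasCompactSupport (μ := μ) hg
    -- Off the support of `g` the error `f - g` is `f` itself.
    refine ⟨tsupport g, hg, le_trans ?_ hfg⟩
    refine le_trans (le_of_eq ?_) (setIntegral_le_integral (s := (tsupport g)ᶜ)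
      (hf.sub hgi).norm (ae_of_all _ fun x => norm_nonneg _))
    refine setIntegral_congr_fun (isClosed_tsupport g).measurableSet.compl fun x hx => ?_
    simp [image_eq_zero_of_notMem_tsupport hx]
  choose K hK hKi using h
  refine ⟨K, hK, ?_⟩
  have hzero : ∫ x in (⋃ n, K n)ᶜ, ‖f x‖ ∂μ = 0 := by
    refine le_antisymm (ge_of_tendsto' tendsto_one_div_add_atTop_nhds_zero_nat fun n => ?_)
      (integral_nonneg fun x => norm_nonneg _)
    refine le_trans (setIntegral_mono_set hf.norm.integrableOn
      (ae_of_all _ fun x => norm_nonneg _) ?_) (hKi n)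
    exact (Set.compl_subset_compl.2 (Set.subset_iUnion K n)).eventuallyLE
  rw [integral_eq_zero_iff_of_nonneg (fun x => norm_nonneg _) hf.norm.integrableOn] at hzero
  filter_upwards [hzero] with x hx
  simpa using hx

/-- The product of an integrable function and a locally measurable, locally essentially bounded
function is integrable. -/
theorem integrable_smul_of_locally_bounded {𝕜 E : Type*} [RCLike 𝕜] [NormedAddCommGroup E]
    [NormedSpace 𝕜 E] {f : G → 𝕜} (hf : Integrable f μ) {k : G → E}
    (hk : ∀ K : Set G, IsCompact K → AEStronglyMeasurable k (μ.restrict K)) {C : ℝ}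
    (hC : ∀ K : Set G, IsCompact K → ∀ᵐ x ∂(μ.restrict K), ‖k x‖ ≤ C) :
    Integrable (fun x => f x • k x) μ := by
  obtain ⟨K, hK, hf0⟩ := exists_isCompact_seq_ae_eq_zero hf
  set S := ⋃ n, K n
  have hSm : MeasurableSet S := MeasurableSet.iUnion fun n => (hK n).measurableSet
  have hkS : AEStronglyMeasurable k (μ.restrict S) :=
    aestronglyMeasurable_iUnion_iff.2 fun n => hk _ (hK n)
  have hCS : ∀ᵐ x ∂(μ.restrict S), ‖k x‖ ≤ C := ae_restrict_iUnion_iff _ _ |>.2 fun n => hC _ (hK n)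
  have h1 : IntegrableOn (fun x => f x • k x) S μ :=
    hf.integrableOn.smul_bdd C hkS hCS
  have h2 : IntegrableOn (fun x => f x • k x) Sᶜ μ := by
    refine (integrableOn_zero (ε' := E) (s := Sᶜ) (μ := μ)).congr ?_
    filter_upwards [hf0] with x hx
    simp [hx]
  have := h1.union h2
  rwa [Set.union_compl_self, integrableOn_univ] at this

/-- The product of an integrable function and a bounded continuous function is integrable. -/
theorem integrable_smul_of_continuous {E : Type*} [NormedAddCommGroup E]
    [NormedSpace ℂ E] (f : Lp ℂ 1 μ) {k : G → E} (hk : Continuous k) {C : ℝ}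
    (hC : ∀ x, ‖k x‖ ≤ C) : Integrable (fun x => f x • k x) μ :=
  integrable_smul_of_locally_bounded (L1.integrable_coeFn f)
    (fun _ hK => hk.continuousOn.aestronglyMeasurable_of_isCompact hK hK.measurableSet)
    fun _ _ => ae_of_all _ hC

/-- Operators of norm at most two that are small on suitable finitely many values of a bounded
continuous function `k` are small on `k` in mean with respect to the integrable density `f`. -/
theorem exists_finset_integral_lt {E : Type*} [NormedAddCommGroup E]
    [NormedSpace ℂ E] (f : Lp ℂ 1 μ) {k : G → E} (hk : Continuous k) {C : ℝ}
    (hC : ∀ x, ‖k x‖ ≤ C) {ε : ℝ} (hε : 0 < ε) :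
    ∃ (S : Finset G) (δ : ℝ), 0 < δ ∧ ∀ T : E →L[ℂ] E, ‖T‖ ≤ 2 → (∀ s ∈ S, ‖T (k s)‖ < δ) →
      ∫ x, ‖f x‖ * ‖T (k x)‖ ∂μ < ε := by
  wlog hC0 : 0 ≤ C generalizing C
  · exact this (C := |C|) (fun x => (hC x).trans (le_abs_self C)) (abs_nonneg C)
  -- The part `f - g`, where `‖T (k x)‖ ≤ 2C`, will contribute at most `ε / 2`; the part `g`, where
  -- `‖T (k x)‖ ≤ 3δ`, at most `3ε / 8`. The added ones avoid division by zero.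
  set η := ε / (4 * (C + 1)) with hη
  have hη0 : 0 < η := by positivity
  obtain ⟨g, hg, hfg, hgc⟩ :=
    exists_continuous_hasCompactSupport_integral_sub_le (L1.integrable_coeFn f) hη0
  have hgi := hgc.integrable_of_hasCompactSupport (μ := μ) hg
  set I := ∫ x, ‖g x‖ ∂μ
  have hI : 0 ≤ I := integral_nonneg fun x => norm_nonneg _
  set δ := ε / (8 * (I + 1)) with hδ
  have hδ0 : 0 < δ := by positivity
  -- `S` is chosen so that every value of `k` on the support of `g` is within `δ` of some `k s`,
  -- independently of `T`.
  obtain ⟨S, -, hS⟩ := hg.isCompact.elim_nhds_subcover (fun s => {y | ‖k y - k s‖ < δ})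
    (fun s _ => by
      have : ContinuousAt (fun y => ‖k y - k s‖) s := by fun_prop
      exact this.eventually_lt continuousAt_const (by simpa using hδ0))
  refine ⟨S, δ, hδ0, fun T hT hTS => ?_⟩
  have hTk : ∀ x, ‖T (k x)‖ ≤ 2 * C := fun x =>
    (T.le_opNorm _).trans (mul_le_mul hT (hC x) (norm_nonneg _) (by norm_num))
  have hsup : ∀ x ∈ tsupport g, ‖T (k x)‖ ≤ 3 * δ := by
    intro x hx
    obtain ⟨s, hs, hxs⟩ := Set.mem_iUnion₂.1 (hS hx)
    have h1 : T (k x) = T (k x - k s) + T (k s) := by rw [map_sub]; abel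
    rw [h1]
    refine (norm_add_le _ _).trans ?_
    have h2 : ‖T (k x - k s)‖ ≤ 2 * δ := (T.le_opNorm _).trans
      (mul_le_mul hT (le_of_lt hxs) (norm_nonneg _) (by norm_num))
    linarith [hTS s hs]
  have hfi := L1.integrable_coeFn f
  have hInt : Integrable (fun x => ‖f x‖ * ‖T (k x)‖) μ := by
    have := (integrable_smul_of_continuous f (T.continuous.comp hk) hTk).norm
    simpa only [norm_smul, Function.comp_apply] using this
  have hbound : ∀ x, ‖f x‖ * ‖T (k x)‖ ≤ ‖f x - g x‖ * (2 * C) + ‖g x‖ * (3 * δ) := by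
    intro x
    have h1 : ‖f x‖ ≤ ‖f x - g x‖ + ‖g x‖ := by
      simpa using norm_add_le (f x - g x) (g x)
    have h2 : ‖g x‖ * ‖T (k x)‖ ≤ ‖g x‖ * (3 * δ) := by
      by_cases hx : x ∈ tsupport g
      · exact mul_le_mul_of_nonneg_left (hsup x hx) (norm_nonneg _)
      · simp [image_eq_zero_of_notMem_tsupport hx]
    calc ‖f x‖ * ‖T (k x)‖ ≤ (‖f x - g x‖ + ‖g x‖) * ‖T (k x)‖ := by gcongr
      _ = ‖f x - g x‖ * ‖T (k x)‖ + ‖g x‖ * ‖T (k x)‖ := by ring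
      _ ≤ _ := add_le_add (mul_le_mul_of_nonneg_left (hTk x) (norm_nonneg _)) h2
  have hi1 := (hfi.sub hgi).norm.mul_const (2 * C)
  have hi2 := hgi.norm.mul_const (3 * δ)
  calc ∫ x, ‖f x‖ * ‖T (k x)‖ ∂μ
      ≤ ∫ x, (‖f x - g x‖ * (2 * C) + ‖g x‖ * (3 * δ)) ∂μ :=
        integral_mono hInt (hi1.add hi2) hbound
    _ = (∫ x, ‖f x - g x‖ ∂μ) * (2 * C) + I * (3 * δ) := by
        rw [← integral_mul_const, ← integral_mul_const]
        exact integral_add hi1 hi2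
    _ ≤ η * (2 * C) + I * (3 * δ) := by gcongr
    _ < ε := by
        have e1 : η * (4 * (C + 1)) = ε := by rw [hη]; field_simp
        have e2 : δ * (8 * (I + 1)) = ε := by rw [hδ]; field_simp
        nlinarith [mul_nonneg hη0.le hC0, mul_nonneg hδ0.le hI]

/-- A strongly continuous family of contractions. -/
structure IsContractiveFamily {E : Type*} [NormedAddCommGroup E] [NormedSpace ℂ E]
    (T : G → E →L[ℂ] E) : Prop where
  norm_apply_le : ∀ y x, ‖T y x‖ ≤ ‖x‖
  continuous_apply : ∀ x, Continuous fun y => T y x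

variable {E : Type*} [NormedAddCommGroup E] [NormedSpace ℂ E]

namespace IsContractiveFamily

variable {T : G → E →L[ℂ] E}

theorem integrable (hT : IsContractiveFamily T) (f : Lp ℂ 1 μ) (x : E) :
    Integrable (fun y => f y • T y x) μ :=
  integrable_smul_of_continuous f (hT.continuous_apply x) fun y => hT.norm_apply_le y x

theorem norm_integral_le (hT : IsContractiveFamily T) (f : Lp ℂ 1 μ) (x : E) :
    ‖∫ y, f y • T y x ∂μ‖ ≤ ‖f‖ * ‖x‖ := by
  refine (norm_integral_le_integral_norm _).trans ?_
  rw [L1.norm_eq_integral_norm f, ← integral_mul_const]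
  refine integral_mono (hT.integrable f x).norm ((L1.integrable_coeFn f).norm.mul_const _)
    fun y => ?_
  simp only [norm_smul]
  exact mul_le_mul_of_nonneg_left (hT.norm_apply_le y x) (norm_nonneg _)

/-- The integrated operator `∫ f(y) T_y dy`. -/
def integ (hT : IsContractiveFamily T) (f : Lp ℂ 1 μ) : E →L[ℂ] E :=
  LinearMap.mkContinuous
    { toFun := fun x => ∫ y, f y • T y x ∂μ
      map_add' := fun x x' => by
        rw [← integral_add (hT.integrable f x) (hT.integrable f x')]
        simp
      map_smul' := fun c x => by
        rw [RingHom.id_apply, ← integral_smul]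
        simp_rw [map_smul, smul_comm c] } ‖f‖ (hT.norm_integral_le f)

theorem integ_apply (hT : IsContractiveFamily T) (f : Lp ℂ 1 μ) (x : E) :
    hT.integ f x = ∫ y, f y • T y x ∂μ := rfl

theorem integ_sub (hT : IsContractiveFamily T) (f g : Lp ℂ 1 μ) (x : E) :
    hT.integ (f - g) x = hT.integ f x - hT.integ g x := by
  simp only [integ_apply]
  rw [← integral_sub (hT.integrable f x) (hT.integrable g x)]
  refine integral_congr_ae ?_
  filter_upwards [Lp.coeFn_sub f g] with y hy
  rw [hy, Pi.sub_apply, sub_smul]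

theorem norm_integ_apply_le (hT : IsContractiveFamily T) (f : Lp ℂ 1 μ) (x : E) :
    ‖hT.integ f x‖ ≤ ‖f‖ * ‖x‖ := hT.norm_integral_le f x

theorem continuous_integ (hT : IsContractiveFamily T) (x : E) :
    Continuous fun f : Lp ℂ 1 μ => hT.integ f x :=
  (LipschitzWith.of_dist_le_mul (K := ‖x‖₊) fun f g => by
    rw [dist_eq_norm, dist_eq_norm, ← hT.integ_sub, mul_comm]
    exact hT.norm_integ_apply_le (f - g) x).continuous

theorem map_integ [CompleteSpace E] {F : Type*} [NormedAddCommGroup F] [NormedSpace ℂ F]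
    [CompleteSpace F] (hT : IsContractiveFamily T) (S : E →L[ℂ] F) (f : Lp ℂ 1 μ) (x : E) :
    S (hT.integ f x) = ∫ y, f y • S (T y x) ∂μ := by
  rw [integ_apply, ← S.integral_comp_comm (hT.integrable f x)]
  simp_rw [map_smul]

/-- An operator intertwining two families intertwines their integrated operators. -/
theorem map_integ_of_intertwine [CompleteSpace E] {F : Type*} [NormedAddCommGroup F]
    [NormedSpace ℂ F] [CompleteSpace F] (hT : IsContractiveFamily T) {T' : G → F →L[ℂ] F}
    (hT' : IsContractiveFamily T') (S : E →L[ℂ] F) (h : ∀ y x, S (T y x) = T' y (S x))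
    (f : Lp ℂ 1 μ) (x : E) : S (hT.integ f x) = hT'.integ f (S x) := by
  simp_rw [map_integ, integ_apply, h]

end IsContractiveFamily

end Integration

/-! ### The modular function and right translation on `L¹(G)` -/

section RightTranslation

set_option linter.unusedSectionVars false

open scoped Pointwise

/-- A closed property that holds for compactly supported continuous functions holds on `L¹`. -/
theorem Lp.induction_hasCompactSupport {G : Type*} [TopologicalSpace G] [MeasurableSpace G]
    [BorelSpace G] [T2Space G] [LocallyCompactSpace G] {μ : Measure G} [μ.Regular]
    {P : Lp ℂ 1 μ → Prop} (hP : IsClosed {a | P a})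
    (h : ∀ (g : G → ℂ) (hg : Continuous g) (hgs : HasCompactSupport g),
      P ((hg.integrable_of_hasCompactSupport hgs).toL1 g)) (a : Lp ℂ 1 μ) : P a := by
  suffices ha : a ∈ closure {a | P a} by rwa [hP.closure_eq] at ha
  refine Metric.mem_closure_iff.2 fun ε hε => ?_
  have hai := L1.integrable_coeFn a
  obtain ⟨g, hgs, hag, hg⟩ := exists_continuous_hasCompactSupport_integral_sub_le hai (half_pos hε)
  have hgi := hg.integrable_of_hasCompactSupport (μ := μ) hgs
  refine ⟨_, h g hg hgs, ?_⟩
  rw [dist_eq_norm, L1.norm_eq_integral_norm]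
  refine lt_of_le_of_lt (le_of_eq_of_le (integral_congr_ae ?_) hag) (half_lt_self hε)
  filter_upwards [Lp.coeFn_sub a (hgi.toL1 g), hgi.coeFn_toL1] with x h1 h2
  rw [h1, Pi.sub_apply, h2]

variable {G : Type*} [Group G] [TopologicalSpace G] [IsTopologicalGroup G]
  [MeasurableSpace G] [BorelSpace G] [LocallyCompactSpace G] [T2Space G]
  (μ : Measure G) [μ.IsHaarMeasure] [μ.Regular]

-- The pushforward is again left invariant and regular, so uniqueness of Haar measure makes it a
-- multiple of `μ`.
open Measure in
theorem map_mul_right_eq_modularCharacterFun_smul (w : G) :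
    μ.map (· * w) = modularCharacterFun w • μ := by
  have : (μ.map (· * w)).Regular := Regular.map (Homeomorph.mulRight w)
  rw [modularCharacterFun_eq_haarScalarFactor μ]
  exact isMulLeftInvariant_eq_smul_of_regular _ μ

open Measure in
theorem integral_comp_mul_right_haar {E : Type*} [NormedAddCommGroup E] [NormedSpace ℝ E]
    (F : G → E) (w : G) :
    ∫ x, F (x * w) ∂μ = (modularCharacterFun w : ℝ) • ∫ x, F x ∂μ := by
  have h := (Homeomorph.mulRight w).isClosedEmbedding.measurableEmbedding.integral_map (μ := μ) F
  simp only [Homeomorph.coe_mulRight] at h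
  rw [← h, map_mul_right_eq_modularCharacterFun_smul, integral_smul_nnreal_measure]
  rfl

theorem quasiMeasurePreserving_mul_right_haar (w : G) :
    Measure.QuasiMeasurePreserving (· * w) μ μ := by
  refine ⟨(continuous_mul_const w).measurable, ?_⟩
  rw [map_mul_right_eq_modularCharacterFun_smul]
  exact Measure.smul_absolutelyContinuous

theorem integrable_comp_mul_right {E : Type*} [NormedAddCommGroup E] {F : G → E}
    (hF : Integrable F μ) (w : G) : Integrable (fun x => F (x * w)) μ := by
  have h := (Homeomorph.mulRight w).isClosedEmbedding.measurableEmbedding.integrable_map_iff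
    (μ := μ) (g := F)
  simp only [Homeomorph.coe_mulRight] at h
  refine h.1 ?_
  rw [map_mul_right_eq_modularCharacterFun_smul]
  exact hF.smul_measure_nnreal

-- The modular function is the quotient `∫ f(xw) dx / ∫ f(x) dx` for any nonzero nonnegative `f` in
-- `C_c`. For `w` in a compact neighbourhood `N` the integrands are supported in the fixed compact
-- set `supp f · N⁻¹`, so the numerator is continuous.
open Measure in
theorem continuous_modularCharacterFun :
    Continuous (fun w : G => (modularCharacterFun w : ℝ)) := by
  borelize G
  obtain ⟨⟨f, hf⟩, hfs, hf0, hf1⟩ : ∃ f : C(G, ℝ), HasCompactSupport f ∧ 0 ≤ f ∧ f 1 ≠ 0 :=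
    exists_continuous_nonneg_pos 1
  have hpos : ∫ x, f x ∂(haar : Measure G) ≠ 0 :=
    ne_of_gt (hf.integral_pos_of_hasCompactSupport_nonneg_nonzero hfs hf0 hf1)
  have h : (fun w : G => (modularCharacterFun w : ℝ)) =
      fun w => (∫ x, f (x * w) ∂(haar : Measure G)) / ∫ x, f x ∂(haar : Measure G) := by
    funext w
    rw [integral_comp_mul_right_haar, smul_eq_mul, mul_div_cancel_right₀ _ hpos]
  rw [h]
  refine Continuous.div_const (continuous_iff_continuousAt.2 fun w₀ => ?_) _
  obtain ⟨N, hN, hNw⟩ := exists_compact_mem_nhds w₀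
  have hc : ContinuousOn (fun w => ∫ x, f (x * w) ∂(haar : Measure G)) N := by
    refine continuousOn_integral_of_compact_support (k := tsupport f * N⁻¹)
      (hfs.isCompact.mul hN.inv) (by fun_prop) fun w x hw hx => ?_
    contrapose! hx
    exact ⟨x * w, subset_tsupport _ hx, w⁻¹, Set.inv_mem_inv.2 hw, by simp⟩
  exact hc.continuousAt hNw

open Measure in
/-- Right translation on `L¹(G)`, the operator `a ↦ a * δ_w` given by
`(a * δ_w)(x) = Δ(w) a(x w⁻¹)`. -/
def rightTranslateₗ (w : G) : Lp ℂ 1 μ →ₗ[ℂ] Lp ℂ 1 μ where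
  toFun a := ((integrable_comp_mul_right μ (L1.integrable_coeFn a) w⁻¹).const_mul
    ((modularCharacterFun w : ℝ) : ℂ)).toL1 _
  map_add' a b := by
    rw [← Integrable.toL1_add]
    refine Integrable.toL1_eq_toL1_iff _ _ _ _ |>.2 ?_
    filter_upwards [(quasiMeasurePreserving_mul_right_haar μ w⁻¹).ae (Lp.coeFn_add a b)] with x hx
    simp only [hx, Pi.add_apply, mul_add]
  map_smul' c a := by
    rw [RingHom.id_apply, ← Integrable.toL1_smul]
    refine Integrable.toL1_eq_toL1_iff _ _ _ _ |>.2 ?_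
    filter_upwards [(quasiMeasurePreserving_mul_right_haar μ w⁻¹).ae (Lp.coeFn_smul c a)] with x hx
    simp only [hx, Pi.smul_apply, smul_eq_mul, mul_left_comm]

open Measure in
theorem coeFn_rightTranslateₗ (w : G) (a : Lp ℂ 1 μ) :
    rightTranslateₗ μ w a =ᵐ[μ] fun x => ((modularCharacterFun w : ℝ) : ℂ) * a (x * w⁻¹) :=
  Integrable.coeFn_toL1 ((integrable_comp_mul_right μ (L1.integrable_coeFn a) w⁻¹).const_mul _)

open Measure in
theorem modularCharacterFun_mul_inv (w : G) :
    (modularCharacterFun w : ℝ) * modularCharacterFun w⁻¹ = 1 := by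
  rw [← NNReal.coe_mul, ← modularCharacterFun_map_mul, mul_inv_cancel, modularCharacterFun_map_one,
    NNReal.coe_one]

theorem norm_rightTranslateₗ (w : G) (a : Lp ℂ 1 μ) : ‖rightTranslateₗ μ w a‖ = ‖a‖ := by
  rw [L1.norm_eq_integral_norm, L1.norm_eq_integral_norm]
  have h : ∀ᵐ x ∂μ, ‖rightTranslateₗ μ w a x‖ =
      Measure.modularCharacterFun w * ‖a (x * w⁻¹)‖ := by
    filter_upwards [coeFn_rightTranslateₗ μ w a] with x hx
    simp [hx]
  rw [integral_congr_ae h, integral_const_mul, integral_comp_mul_right_haar μ (fun x => ‖a x‖),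
    smul_eq_mul, ← mul_assoc, modularCharacterFun_mul_inv, one_mul]

/-- Right translation on `L¹(G)` as a continuous linear map. -/
def rightTranslateL (w : G) : Lp ℂ 1 μ →L[ℂ] Lp ℂ 1 μ :=
  (⟨rightTranslateₗ μ w, norm_rightTranslateₗ μ w⟩ : Lp ℂ 1 μ →ₗᵢ[ℂ] Lp ℂ 1 μ).toContinuousLinearMap

variable {μ}

theorem norm_rightTranslateL_apply (w : G) (a : Lp ℂ 1 μ) : ‖rightTranslateL μ w a‖ = ‖a‖ :=
  norm_rightTranslateₗ μ w a

theorem coeFn_rightTranslateL (w : G) (a : Lp ℂ 1 μ) : rightTranslateL μ w a =ᵐ[μ]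
    fun x => ((Measure.modularCharacterFun w : ℝ) : ℂ) * a (x * w⁻¹) :=
  coeFn_rightTranslateₗ μ w a

theorem rightTranslateL_mul (y z : G) (a : Lp ℂ 1 μ) :
    rightTranslateL μ (y * z) a = rightTranslateL μ z (rightTranslateL μ y a) := by
  refine Lp.ext ?_
  filter_upwards [coeFn_rightTranslateL (y * z) a, coeFn_rightTranslateL z (rightTranslateL μ y a),
    (quasiMeasurePreserving_mul_right_haar μ z⁻¹).ae (coeFn_rightTranslateL y a)] with x h1 h2 h3
  rw [h1, h2, h3, Measure.modularCharacterFun_map_mul]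
  push_cast
  simp only [mul_inv_rev, mul_assoc]
  ring

theorem rightTranslateL_leftTranslate (w y : G) (a : Lp ℂ 1 μ) :
    rightTranslateL μ w (leftTranslate y a) = leftTranslate y (rightTranslateL μ w a) := by
  refine Lp.ext ?_
  filter_upwards [coeFn_rightTranslateL w (leftTranslate y a),
    (quasiMeasurePreserving_mul_right_haar μ w⁻¹).ae (coeFn_leftTranslate y a),
    coeFn_leftTranslate y (rightTranslateL μ w a),
    (measurePreserving_mul_left μ y⁻¹).quasiMeasurePreserving.ae (coeFn_rightTranslateL w a)]
    with x h1 h2 h3 h4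
  rw [h1, h2, h3, h4, mul_assoc]

/-- This is associativity across the point mass, `(a * δ_w) * g = a * (δ_w * g)`. After
multiplication by `Δ(w)` it is the substitution `y ↦ y w`. -/
theorem rightTranslateL_conv (w : G) (a g : Lp ℂ 1 μ) :
    l1Conv (rightTranslateL μ w a) g = l1Conv a (leftTranslate w g) := by
  have hΔ : ((Measure.modularCharacterFun w : ℝ) : ℝ) ≠ 0 :=
    (NNReal.coe_pos.2 (Measure.modularCharacterFun_pos w)).ne'
  refine smul_right_injective _ hΔ ?_
  simp only [l1Conv]
  rw [← integral_comp_mul_right_haar, ← integral_smul]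
  refine integral_congr_ae ?_
  filter_upwards [(quasiMeasurePreserving_mul_right_haar μ w).ae (coeFn_rightTranslateL w a)]
    with y hy
  rw [hy, mul_inv_cancel_right, leftTranslate_mul, mul_smul]
  exact algebraMap_smul ℂ (Measure.modularCharacterFun w : ℝ)
    (a y • leftTranslate y (leftTranslate w g))

/-- Right translations are isometries, so the property passes to limits by an `ε / 3` argument. For
`g` in `C_c` the integral depends continuously on `w`, since near `1` all integrands live on one
compact set. -/
theorem tendsto_rightTranslateL_one (a : Lp ℂ 1 μ) :
    Tendsto (fun w => ‖rightTranslateL μ w a - a‖) (𝓝 1) (𝓝 0) := by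
  induction a using Lp.induction_hasCompactSupport with
  | hP =>
    refine isClosed_iff_clusterPt.2 fun a ha => ?_
    refine tendsto_order.2 ⟨fun c hc => Eventually.of_forall fun w => hc.trans_le (norm_nonneg _),
      fun ε hε => ?_⟩
    obtain ⟨b, hb, hab⟩ := Metric.mem_closure_iff.1 (mem_closure_iff_clusterPt.2 ha) (ε / 3)
      (by positivity)
    filter_upwards [(tendsto_order.1 hb).2 (ε / 3) (by positivity)] with w hw
    have h1 : rightTranslateL μ w a - a =
        rightTranslateL μ w (a - b) + (rightTranslateL μ w b - b) + (b - a) := by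
      rw [map_sub]; abel
    rw [dist_eq_norm] at hab
    calc ‖rightTranslateL μ w a - a‖ ≤ ‖a - b‖ + ‖rightTranslateL μ w b - b‖ + ‖b - a‖ := by
          rw [h1]
          refine (norm_add₃_le).trans ?_
          rw [norm_rightTranslateL_apply]
      _ < ε := by rw [norm_sub_rev b a]; linarith
  | h g hg hgs =>
    obtain ⟨N, hN, hN1⟩ := exists_compact_mem_nhds (1 : G)
    have hgi := hg.integrable_of_hasCompactSupport (μ := μ) hgs
    have h : ∀ w, ‖rightTranslateL μ w (hgi.toL1 g) - hgi.toL1 g‖ =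
        ∫ x, ‖((Measure.modularCharacterFun w : ℝ) : ℂ) * g (x * w⁻¹) - g x‖ ∂μ := by
      intro w
      rw [L1.norm_eq_integral_norm]
      refine integral_congr_ae ?_
      filter_upwards [Lp.coeFn_sub (rightTranslateL μ w (hgi.toL1 g)) (hgi.toL1 g),
        hgi.coeFn_toL1, coeFn_rightTranslateL w (hgi.toL1 g),
        (quasiMeasurePreserving_mul_right_haar μ w⁻¹).ae hgi.coeFn_toL1] with x h1 h2 h3 h4
      rw [h1, Pi.sub_apply, h2, h3, h4]
    have hm : Continuous (fun w : G => (Measure.modularCharacterFun w : ℝ)) :=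
      continuous_modularCharacterFun
    have hc : ContinuousOn (fun w =>
        ∫ x, ‖((Measure.modularCharacterFun w : ℝ) : ℂ) * g (x * w⁻¹) - g x‖ ∂μ) N := by
      refine continuousOn_integral_of_compact_support (k := tsupport g * N ∪ tsupport g)
        ((hgs.isCompact.mul hN).union hgs) ?_ fun w x hw hx => ?_
      · have : Continuous fun p : G × G => ‖((Measure.modularCharacterFun p.1 : ℝ) : ℂ) *
            g (p.2 * p.1⁻¹) - g p.2‖ := by
          have := Complex.continuous_ofReal.comp (hm.comp (continuous_fst (X := G) (Y := G)))
          exact ((this.mul (by fun_prop)).sub (by fun_prop)).norm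
        exact this.continuousOn
      · rw [Set.mem_union, not_or] at hx
        have h1 : g (x * w⁻¹) = 0 := by
          by_contra h1
          exact hx.1 ⟨x * w⁻¹, subset_tsupport _ h1, w, hw, by simp⟩
        simp [h1, image_eq_zero_of_notMem_tsupport hx.2]
    have := (hc.continuousAt hN1).tendsto
    simp_rw [h]
    simpa [Measure.modularCharacterFun_map_one] using this

theorem continuous_rightTranslateL (a : Lp ℂ 1 μ) :
    Continuous fun w : G => rightTranslateL μ w a := by
  refine continuous_iff_continuousAt.2 fun w₀ => tendsto_iff_norm_sub_tendsto_zero.2 ?_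
  have h : ∀ w, ‖rightTranslateL μ w a - rightTranslateL μ w₀ a‖ =
      ‖rightTranslateL μ (w * w₀⁻¹) a - a‖ := by
    intro w
    rw [← norm_rightTranslateL_apply w₀ (rightTranslateL μ (w * w₀⁻¹) a - a), map_sub,
      ← rightTranslateL_mul, inv_mul_cancel_right]
  simp_rw [h]
  refine (tendsto_rightTranslateL_one a).comp ?_
  have : Continuous fun w : G => w * w₀⁻¹ := by fun_prop
  simpa using this.tendsto w₀

theorem isContractiveFamily_leftTranslateL : IsContractiveFamily (leftTranslateL μ) :=
  ⟨fun y a => (norm_leftTranslate y a).le, continuous_leftTranslate⟩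

theorem isContractiveFamily_rightTranslateL : IsContractiveFamily (rightTranslateL μ) :=
  ⟨fun y a => (norm_rightTranslateL_apply y a).le, continuous_rightTranslateL⟩

end RightTranslation

/-! ### Convolution as an average of translates, augmentation and approximate units -/

section Convolution

set_option linter.unusedSectionVars false

open scoped BoundedContinuousFunction

section Pairing

variable {G : Type*} [TopologicalSpace G] [MeasurableSpace G] [BorelSpace G] [T2Space G]
  [LocallyCompactSpace G] {μ : Measure G} [μ.Regular]

variable (μ) in
/-- The functional `a ↦ ∫ a k` on `L¹` given by a bounded continuous function `k`. -/
def pairing (k : G →ᵇ ℂ) : Lp ℂ 1 μ →L[ℂ] ℂ :=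
  LinearMap.mkContinuous
    { toFun := fun a => ∫ x, a x • k x ∂μ
      map_add' := fun a b => by
        rw [← integral_add (integrable_smul_of_continuous a k.continuous k.norm_coe_le_norm)
          (integrable_smul_of_continuous b k.continuous k.norm_coe_le_norm)]
        refine integral_congr_ae ?_
        filter_upwards [Lp.coeFn_add a b] with x hx
        rw [hx, Pi.add_apply, add_smul]
      map_smul' := fun c a => by
        rw [RingHom.id_apply, ← integral_smul]
        refine integral_congr_ae ?_
        filter_upwards [Lp.coeFn_smul c a] with x hx
        rw [hx, Pi.smul_apply, smul_assoc] } ‖k‖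
    (fun a => by
      change ‖∫ x, a x • k x ∂μ‖ ≤ _
      refine (norm_integral_le_integral_norm _).trans ?_
      rw [L1.norm_eq_integral_norm a, ← integral_const_mul]
      refine integral_mono
        (integrable_smul_of_continuous a k.continuous k.norm_coe_le_norm).norm
        ((L1.integrable_coeFn a).norm.const_mul _) fun x => ?_
      rw [norm_smul, mul_comm]
      exact mul_le_mul_of_nonneg_right (k.norm_coe_le_norm x) (norm_nonneg _))

theorem pairing_apply (k : G →ᵇ ℂ) (a : Lp ℂ 1 μ) : pairing μ k a = ∫ x, a x • k x ∂μ := rfl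

/-- Compactly supported continuous functions separate the points of `L¹`. -/
theorem eq_zero_of_pairing_eq_zero {a : Lp ℂ 1 μ}
    (h : ∀ k : G →ᵇ ℂ, HasCompactSupport k → pairing μ k a = 0) : a = 0 := by
  rw [← norm_le_zero_iff]
  refine le_of_forall_pos_le_add fun ε hε => ?_
  have hai := L1.integrable_coeFn a
  obtain ⟨g, hgs, hag, hg⟩ := exists_continuous_hasCompactSupport_integral_sub_le hai
    (ε := ε / 3) (by positivity)
  have hgi := hg.integrable_of_hasCompactSupport (μ := μ) hgs
  set M := μ.real (tsupport g)
  have hM : 0 ≤ M := measureReal_nonneg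
  set δ := ε / (3 * (M + 1)) with hδ
  have hδ0 : 0 < δ := by positivity
  have hden : ∀ x, 0 < ‖g x‖ + δ := fun x => by positivity
  -- A continuous substitute for the phase `conj g / |g|`; the summand `δ` removes the singularity
  -- at zeros of `g` and costs at most `δ · μ(supp g)` in `∫ g k`.
  let k : G →ᵇ ℂ := BoundedContinuousFunction.ofNormedAddCommGroup
    (fun x => ((‖g x‖ + δ : ℝ) : ℂ)⁻¹ * (starRingEnd ℂ) (g x))
    (by
      refine Continuous.mul (Continuous.inv₀ (by fun_prop) fun x => ?_)
        (Complex.continuous_conj.comp hg)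
      exact_mod_cast (hden x).ne') 1
    (fun x => by
      rw [norm_mul, norm_inv, Complex.norm_real, RCLike.norm_conj, Real.norm_eq_abs,
        abs_of_pos (hden x), inv_mul_le_one₀ (hden x)]
      linarith)
  have hk1 : ∀ x, ‖k x‖ ≤ 1 := fun x => by
    change ‖((‖g x‖ + δ : ℝ) : ℂ)⁻¹ * (starRingEnd ℂ) (g x)‖ ≤ 1
    rw [norm_mul, norm_inv, Complex.norm_real, RCLike.norm_conj, Real.norm_eq_abs,
        abs_of_pos (hden x), inv_mul_le_one₀ (hden x)]
    linarith
  have hks : HasCompactSupport k :=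
    hgs.mono fun x hx => by
      contrapose! hx
      have : g x = 0 := by simpa using hx
      change ¬ (((‖g x‖ + δ : ℝ) : ℂ)⁻¹ * (starRingEnd ℂ) (g x) ≠ 0)
      simp [this]
  have hgk : ∀ x, g x * k x = ((‖g x‖ ^ 2 / (‖g x‖ + δ) : ℝ) : ℂ) := fun x => by
    change g x * (((‖g x‖ + δ : ℝ) : ℂ)⁻¹ * (starRingEnd ℂ) (g x)) = _
    rw [mul_left_comm, Complex.mul_conj, Complex.normSq_eq_norm_sq]
    push_cast
    rw [div_eq_inv_mul]
  have hgki : Integrable (fun x => g x * k x) μ := by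
    refine (hg.mul k.continuous).integrable_of_hasCompactSupport (hgs.mul_right)
  have hzero := h k hks
  have hle : ‖∫ x, g x * k x ∂μ‖ ≤ ε / 3 := by
    have h1 : ∫ x, g x * k x ∂μ = -∫ x, (a x - g x) * k x ∂μ := by
      rw [← integral_neg, ← sub_eq_zero, ← integral_sub hgki]
      · rw [← hzero, pairing_apply]
        refine integral_congr_ae (ae_of_all _ fun x => ?_)
        simp only [smul_eq_mul]
        ring
      · exact (integrable_smul_of_locally_bounded (hai.sub hgi)
          (fun K hK => k.continuous.continuousOn.aestronglyMeasurable_of_isCompact hK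
            hK.measurableSet) fun _ _ => ae_of_all _ hk1).neg
    rw [h1, norm_neg]
    refine (norm_integral_le_of_norm_le (hai.sub hgi).norm (ae_of_all _ fun x => ?_)).trans hag
    rw [norm_mul]
    exact mul_le_of_le_one_right (norm_nonneg _) (hk1 x)
  have hInt : ∫ x, ‖g x‖ ∂μ - δ * M ≤ ‖∫ x, g x * k x ∂μ‖ := by
    have h2 : Integrable (fun x => ‖g x‖ ^ 2 / (‖g x‖ + δ)) μ := by
      refine hgki.re.congr (ae_of_all _ fun x => ?_)
      beta_reduce
      rw [hgk]
      exact Complex.ofReal_re _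
    simp_rw [hgk]
    rw [integral_complex_ofReal, Complex.norm_real]
    refine le_trans ?_ (le_abs_self _)
    rw [sub_le_iff_le_add, ← setIntegral_eq_integral_of_forall_compl_eq_zero (s := tsupport g)
      (fun x hx => by rw [image_eq_zero_of_notMem_tsupport hx, norm_zero])]
    have hsm := (isClosed_tsupport g).measurableSet
    have hconst : IntegrableOn (fun _ : G => δ) (tsupport g) μ :=
      integrableOn_const hgs.isCompact.measure_lt_top.ne
    calc ∫ x in tsupport g, ‖g x‖ ∂μ
        ≤ ∫ x in tsupport g, (‖g x‖ ^ 2 / (‖g x‖ + δ) + δ) ∂μ := by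
          refine setIntegral_mono hgi.norm.integrableOn (h2.integrableOn.add hconst) fun x => ?_
          change ‖g x‖ ≤ ‖g x‖ ^ 2 / (‖g x‖ + δ) + δ
          rw [← sub_le_iff_le_add, le_div_iff₀ (hden x)]
          nlinarith [hδ0]
      _ = (∫ x in tsupport g, ‖g x‖ ^ 2 / (‖g x‖ + δ) ∂μ) + δ * M := by
          rw [integral_add h2.integrableOn hconst, setIntegral_const, smul_eq_mul, mul_comm M]
      _ ≤ _ := by
          refine add_le_add (setIntegral_le_integral h2 (ae_of_all _ fun x => ?_)) le_rfl
          change 0 ≤ ‖g x‖ ^ 2 / (‖g x‖ + δ)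
          positivity
  have hδM : δ * M ≤ ε / 3 := by
    have : δ * (3 * (M + 1)) = ε := by rw [hδ]; field_simp
    nlinarith
  calc ‖a‖ = ∫ x, ‖a x‖ ∂μ := L1.norm_eq_integral_norm a
    _ ≤ ∫ x, (‖a x - g x‖ + ‖g x‖) ∂μ := by
        refine integral_mono hai.norm ((hai.sub hgi).norm.add hgi.norm) fun x => ?_
        simpa using norm_add_le (a x - g x) (g x)
    _ = (∫ x, ‖a x - g x‖ ∂μ) + ∫ x, ‖g x‖ ∂μ := integral_add (hai.sub hgi).norm hgi.norm
    _ ≤ 0 + ε := by linarith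

end Pairing

variable {G : Type*} [Group G] [TopologicalSpace G] [IsTopologicalGroup G]
  [MeasurableSpace G] [BorelSpace G] [LocallyCompactSpace G] [T2Space G]
  {μ : Measure G} [μ.IsHaarMeasure] [μ.Regular]

theorem pairing_leftTranslate (k : G →ᵇ ℂ) (y : G) (a : Lp ℂ 1 μ) :
    pairing μ k (leftTranslate y a) = ∫ x, a x • k (y * x) ∂μ := by
  rw [pairing_apply, ← integral_mul_left_eq_self _ y]
  refine integral_congr_ae ?_
  filter_upwards [(measurePreserving_mul_left μ y).quasiMeasurePreserving.ae
    (coeFn_leftTranslate y a)] with x hx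
  rw [hx, inv_mul_cancel_left]

theorem pairing_rightTranslateL (k : G →ᵇ ℂ) (w : G) (a : Lp ℂ 1 μ) :
    pairing μ k (rightTranslateL μ w a) = ∫ x, a x • k (x * w) ∂μ := by
  have hΔ : ((Measure.modularCharacterFun w : ℝ) : ℝ) ≠ 0 :=
    (NNReal.coe_pos.2 (Measure.modularCharacterFun_pos w)).ne'
  refine smul_right_injective _ hΔ ?_
  simp only [pairing_apply]
  rw [← integral_comp_mul_right_haar, ← integral_smul]
  refine integral_congr_ae ?_
  filter_upwards [(quasiMeasurePreserving_mul_right_haar μ w).ae (coeFn_rightTranslateL w a)]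
    with y hy
  rw [hy, mul_inv_cancel_right]
  simp [mul_assoc]

theorem conv_eq_integ_left (a b : Lp ℂ 1 μ) :
    l1Conv a b = isContractiveFamily_leftTranslateL.integ a b := rfl

/-- Convolution as an average of right translates, `a * b = ∫ b(w) (a * δ_w) dw`. -/
theorem conv_eq_integ_right (a b : Lp ℂ 1 μ) :
    l1Conv a b = isContractiveFamily_rightTranslateL.integ b a := by
  induction a using Lp.induction_hasCompactSupport with
  | hP => exact isClosed_eq (convRightL b).continuous (ContinuousLinearMap.continuous _)
  | h g hg hgs =>
  induction b using Lp.induction_hasCompactSupport with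
  | hP =>
    simp_rw [conv_eq_integ_left]
    exact isClosed_eq (ContinuousLinearMap.continuous _) (IsContractiveFamily.continuous_integ _ _)
  | h f hf hfs =>
  have hgi := hg.integrable_of_hasCompactSupport (μ := μ) hgs
  have hfi := hf.integrable_of_hasCompactSupport (μ := μ) hfs
  rw [← sub_eq_zero]
  -- Tested against `k`, both sides become iterated integrals of `g(y) f(x) k(yx)` in opposite
  -- orders. The integrand is continuous with compact support, so the order can be exchanged without
  -- `σ`-finiteness.
  refine eq_zero_of_pairing_eq_zero fun k hk => ?_
  rw [map_sub, sub_eq_zero, conv_eq_integ_left, IsContractiveFamily.map_integ,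
    IsContractiveFamily.map_integ]
  have h1 : ∫ y, hgi.toL1 g y • pairing μ k (leftTranslateL μ y (hfi.toL1 f)) ∂μ =
      ∫ y, ∫ x, g y * (f x * k (y * x)) ∂μ ∂μ := by
    refine integral_congr_ae ?_
    filter_upwards [hgi.coeFn_toL1] with y hy
    rw [hy, leftTranslateL_apply, pairing_leftTranslate, smul_eq_mul, integral_const_mul]
    congr 1
    refine integral_congr_ae ?_
    filter_upwards [hfi.coeFn_toL1] with x hx
    rw [hx, smul_eq_mul]
  have h2 : ∫ w, hfi.toL1 f w • pairing μ k (rightTranslateL μ w (hgi.toL1 g)) ∂μ =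
      ∫ w, ∫ x, g x * (f w * k (x * w)) ∂μ ∂μ := by
    refine integral_congr_ae ?_
    filter_upwards [hfi.coeFn_toL1] with w hw
    rw [hw, pairing_rightTranslateL, smul_eq_mul, ← integral_const_mul]
    refine integral_congr_ae ?_
    filter_upwards [hgi.coeFn_toL1] with x hx
    rw [hx, smul_eq_mul]
    ring
  rw [h1, h2]
  refine integral_integral_swap_of_hasCompactSupport (by fun_prop) ?_
  refine HasCompactSupport.intro (hgs.isCompact.prod hfs.isCompact) fun p hp => ?_
  rw [Set.mem_prod, not_and_or] at hp
  change g p.1 * (f p.2 * k (p.1 * p.2)) = 0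
  rcases hp with hp | hp
  · rw [image_eq_zero_of_notMem_tsupport hp, zero_mul]
  · rw [image_eq_zero_of_notMem_tsupport hp, zero_mul, mul_zero]

variable (μ) in
/-- The augmentation character `a ↦ ∫ a` of `L¹(G)`. -/
def augmentation : Lp ℂ 1 μ →L[ℂ] ℂ := pairing μ (BoundedContinuousFunction.const G 1)

theorem augmentation_apply (a : Lp ℂ 1 μ) : augmentation μ a = ∫ x, a x ∂μ := by
  simp [augmentation, pairing_apply]

theorem norm_augmentation_le (a : Lp ℂ 1 μ) : ‖augmentation μ a‖ ≤ ‖a‖ := by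
  rw [augmentation_apply, L1.norm_eq_integral_norm]
  exact norm_integral_le_integral_norm _

theorem augmentation_leftTranslate (y : G) (a : Lp ℂ 1 μ) :
    augmentation μ (leftTranslate y a) = augmentation μ a := by
  rw [augmentation, pairing_leftTranslate, pairing_apply]
  simp

theorem augmentation_conv (a b : Lp ℂ 1 μ) :
    augmentation μ (l1Conv a b) = augmentation μ a * augmentation μ b := by
  rw [conv_eq_integ_left, IsContractiveFamily.map_integ]
  simp_rw [leftTranslateL_apply, augmentation_leftTranslate, smul_eq_mul]
  rw [integral_mul_const, augmentation_apply a]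

theorem conv_sub_augmentation_smul (u a : Lp ℂ 1 μ) :
    l1Conv u a - augmentation μ u • a = ∫ y, u y • (leftTranslate y a - a) ∂μ := by
  simp_rw [smul_sub]
  rw [integral_sub (integrable_smul_leftTranslate u a) ((L1.integrable_coeFn u).smul_const a),
    integral_smul_const, augmentation_apply]
  rfl

/-- `L¹(G)` has a left approximate identity of functions with norm and integral one. -/
theorem exists_left_approximate_unit (S : Finset (Lp ℂ 1 μ)) {ε : ℝ} (hε : 0 < ε) :
    ∃ u : Lp ℂ 1 μ, ‖u‖ ≤ 1 ∧ augmentation μ u = 1 ∧ ∀ a ∈ S, ‖l1Conv u a - a‖ < ε := by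
  have hV : ∀ᶠ y in 𝓝 (1 : G), ∀ a ∈ S, ‖leftTranslate y a - a‖ < ε / 2 := by
    refine (Finset.eventually_all S).2 fun a _ => ?_
    have hone : leftTranslate 1 a = a := by
      refine Lp.ext ?_
      filter_upwards [coeFn_leftTranslate 1 a] with x hx
      rw [hx, inv_one, one_mul]
    have : ContinuousAt (fun y : G => ‖leftTranslate y a - a‖) 1 :=
      ((continuous_leftTranslate a).sub continuous_const).norm.continuousAt
    exact this.eventually_lt continuousAt_const (by simpa [hone] using hε)
  obtain ⟨K, hK1, hKV, hK⟩ := local_compact_nhds hV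
  have hμK : μ K ≠ ∞ := hK.measure_lt_top.ne
  have hμK0 : 0 < μ.real K :=
    ENNReal.toReal_pos (Measure.measure_pos_of_mem_nhds μ hK1).ne' hμK
  -- The unit is the normalized indicator of a compact neighbourhood of `1` whose elements move
  -- every `a ∈ S` by less than `ε / 2`.
  set c : ℂ := (((μ.real K)⁻¹ : ℝ) : ℂ) with hc
  set u := indicatorConstLp 1 hK.measurableSet hμK c with hu
  have hu1 : ‖u‖ = 1 := by
    rw [hu, norm_indicatorConstLp one_ne_zero ENNReal.one_ne_top, hc, Complex.norm_real,
      Real.norm_eq_abs, abs_of_pos (inv_pos.2 hμK0)]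
    simp [hμK0.ne']
  have huφ : augmentation μ u = 1 := by
    rw [augmentation_apply, hu, integral_indicatorConstLp, hc, ← Complex.coe_smul, smul_eq_mul,
      ← Complex.ofReal_mul, mul_inv_cancel₀ hμK0.ne', Complex.ofReal_one]
  refine ⟨u, hu1.le, huφ, fun a ha => ?_⟩
  have h1 := conv_sub_augmentation_smul u a
  rw [huφ, one_smul] at h1
  rw [h1]
  have hbd : ‖∫ y, u y • (leftTranslate y a - a) ∂μ‖ ≤ ∫ y, ‖u y‖ * (ε / 2) ∂μ := by
    refine norm_integral_le_of_norm_le ((L1.integrable_coeFn u).norm.mul_const _) ?_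
    filter_upwards [indicatorConstLp_coeFn (p := 1) (hs := hK.measurableSet) (hμs := hμK) (c := c)]
      with y hy
    rw [norm_smul]
    by_cases hyK : y ∈ K
    · exact mul_le_mul_of_nonneg_left (hKV hyK a ha).le (norm_nonneg _)
    · rw [hu, hy, Set.indicator_of_notMem hyK]
      simp
  rw [integral_mul_const, ← L1.norm_eq_integral_norm, hu1, one_mul] at hbd
  linarith

end Convolution

/-! ### From an invariant mean to almost invariant functions -/

section Reiter

open scoped BoundedContinuousFunction

variable {G : Type*} [TopologicalSpace G] [MeasurableSpace G] [BorelSpace G] {μ : Measure G}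

variable (μ) in
/-- A bounded continuous function as an element of `LInftyFun μ`. -/
def LInftyFun.ofBounded (H : G →ᵇ ℝ) : LInftyFun μ :=
  ⟨H, fun _ _ => H.continuous.aemeasurable, ‖H‖, fun _ _ => ae_of_all _ H.norm_coe_le_norm⟩

/-- Apply positivity to `C - H` and `C + H`. -/
theorem abs_mean_ofBounded_le {m : LInftyFun μ →ₗ[ℝ] ℝ} (hm1 : m (LInftyFun.one μ) = 1)
    (hm : ∀ f : LInftyFun μ,
      (∀ K : Set G, IsCompact K → ∀ᵐ x ∂(μ.restrict K), 0 ≤ f.1 x) → 0 ≤ m f)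
    (H : G →ᵇ ℝ) {C : ℝ} (hC : ∀ x, |H x| ≤ C) : |m (LInftyFun.ofBounded μ H)| ≤ C := by
  have h1 := hm (C • LInftyFun.one μ - LInftyFun.ofBounded μ H) fun _ _ => ae_of_all _ fun x => by
    change 0 ≤ C * 1 - H x
    linarith [(abs_le.1 (hC x)).2]
  have h2 := hm (C • LInftyFun.one μ + LInftyFun.ofBounded μ H) fun _ _ => ae_of_all _ fun x => by
    change 0 ≤ C * 1 + H x
    linarith [(abs_le.1 (hC x)).1]
  rw [map_sub, map_smul, hm1, smul_eq_mul, mul_one] at h1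
  rw [map_add, map_smul, hm1, smul_eq_mul, mul_one] at h2
  exact abs_le.2 ⟨by linarith, by linarith⟩

variable [Group G] [IsTopologicalGroup G] [LocallyCompactSpace G] [T2Space G]
  [μ.IsHaarMeasure] [μ.Regular]

/-- The coefficient function `x ↦ Re ψ(a * L_x e)`. -/
def coefficient (ψ : Lp ℂ 1 μ →L[ℂ] ℂ) (e a : Lp ℂ 1 μ) : G →ᵇ ℝ :=
  BoundedContinuousFunction.ofNormedAddCommGroup (fun x => (ψ (l1Conv a (leftTranslate x e))).re)
    (Complex.continuous_re.comp (ψ.continuous.comp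
      ((isContractiveFamily_leftTranslateL.integ a).continuous.comp (continuous_leftTranslate e))))
    (‖ψ‖ * ‖e‖ * ‖a‖)
    (fun x => by
      refine (Complex.abs_re_le_norm _).trans ((ψ.le_opNorm _).trans ?_)
      rw [mul_assoc]
      refine mul_le_mul_of_nonneg_left ((norm_conv_le _ _).trans_eq ?_) (norm_nonneg _)
      rw [norm_leftTranslate, mul_comm])

theorem coefficient_apply (ψ : Lp ℂ 1 μ →L[ℂ] ℂ) (e a : Lp ℂ 1 μ) (x : G) :
    coefficient ψ e a x = (ψ (l1Conv a (leftTranslate x e))).re := rfl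

theorem abs_coefficient_le (ψ : Lp ℂ 1 μ →L[ℂ] ℂ) (e a : Lp ℂ 1 μ) (x : G) :
    |coefficient ψ e a x| ≤ ‖ψ‖ * ‖e‖ * ‖a‖ := by
  rw [coefficient_apply]
  refine (Complex.abs_re_le_norm _).trans ((ψ.le_opNorm _).trans ?_)
  rw [mul_assoc]
  refine mul_le_mul_of_nonneg_left ((norm_conv_le _ _).trans_eq ?_) (norm_nonneg _)
  rw [norm_leftTranslate, mul_comm]

/-- A left invariant mean annihilates the coefficient functions of elements of integral zero. -/
theorem mean_coefficient_eq_zero {m : LInftyFun μ →ₗ[ℝ] ℝ} (hm1 : m (LInftyFun.one μ) = 1)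
    (hm : ∀ f : LInftyFun μ,
      (∀ K : Set G, IsCompact K → ∀ᵐ x ∂(μ.restrict K), 0 ≤ f.1 x) → 0 ≤ m f)
    (hinv : ∀ (x : G) (f : LInftyFun μ), m (LInftyFun.translate x f) = m f)
    (ψ : Lp ℂ 1 μ →L[ℂ] ℂ) (e b : Lp ℂ 1 μ) (hb : augmentation μ b = 0) :
    m (LInftyFun.ofBounded μ (coefficient ψ e b)) = 0 := by
  let F₀ : Lp ℂ 1 μ →+ ℝ := AddMonoidHom.mk'
    (fun a => m (LInftyFun.ofBounded μ (coefficient ψ e a))) fun a b => by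
      rw [← map_add]
      congr 1
      refine Subtype.ext (funext fun x => ?_)
      change coefficient ψ e (a + b) x = coefficient ψ e a x + coefficient ψ e b x
      simp only [coefficient_apply, add_conv, map_add, Complex.add_re]
  have hF₀ : ∀ a, ‖F₀ a‖ ≤ ‖ψ‖ * ‖e‖ * ‖a‖ := fun a =>
    abs_mean_ofBounded_le hm1 hm _ (abs_coefficient_le ψ e a)
  -- A continuous additive map is automatically real-linear. Because of the real part `F` is not
  -- complex-linear.
  let F : Lp ℂ 1 μ →L[ℝ] ℝ :=
    F₀.toRealLinearMap (AddMonoidHomClass.continuous_of_bound F₀ (‖ψ‖ * ‖e‖) hF₀)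
  -- Since `(a * δ_w) * L_x e = a * L_{wx} e`, a right translate of `a` has a left translate of its
  -- coefficient function.
  have hρ : ∀ w a, F (rightTranslateL μ w a) = F a := by
    intro w a
    change m (LInftyFun.ofBounded μ (coefficient ψ e (rightTranslateL μ w a))) =
      m (LInftyFun.ofBounded μ (coefficient ψ e a))
    rw [← hinv w⁻¹ (LInftyFun.ofBounded μ (coefficient ψ e a))]
    congr 1
    refine Subtype.ext (funext fun x => ?_)
    change coefficient ψ e (rightTranslateL μ w a) x = coefficient ψ e a (w⁻¹⁻¹ * x)
    rw [coefficient_apply, coefficient_apply, rightTranslateL_conv, inv_inv, leftTranslate_mul]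
  have hconv : ∀ u, F (l1Conv u b) = 0 := by
    intro u
    have hi := isContractiveFamily_rightTranslateL.integrable b u
    have hF : F (isContractiveFamily_rightTranslateL.integ b u) =
        ∫ y, F (b y • rightTranslateL μ y u) ∂μ := (F.integral_comp_comm hi).symm
    rw [conv_eq_integ_right, hF]
    -- The complex scalar `b y` cannot leave the real-linear `F`, so it is moved inside the
    -- translation, which `F` then ignores. What remains is `F` of `(∫ b) • u = 0`.
    simp_rw [← map_smul, hρ]
    rw [F.integral_comp_comm ((L1.integrable_coeFn b).smul_const u), integral_smul_const,
      ← augmentation_apply, hb, zero_smul, map_zero]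
  change F b = 0
  rw [← abs_nonpos_iff]
  refine le_of_forall_pos_le_add fun ε hε => ?_
  obtain ⟨u, -, -, hu⟩ := exists_left_approximate_unit {b}
    (ε := ε / (‖ψ‖ * ‖e‖ + 1)) (by positivity)
  have h1 : F b = -F (l1Conv u b - b) := by rw [map_sub, hconv]; ring
  rw [h1, abs_neg, zero_add]
  refine (hF₀ _).trans ?_
  have h2 := (hu b (Finset.mem_singleton_self b)).le
  have h3 : 0 ≤ ‖ψ‖ * ‖e‖ := by positivity
  calc ‖ψ‖ * ‖e‖ * ‖l1Conv u b - b‖ ≤ (‖ψ‖ * ‖e‖ + 1) * (ε / (‖ψ‖ * ‖e‖ + 1)) := by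
        gcongr
        linarith
    _ = ε := by field_simp

/-- On an amenable group there are functions in `L¹(G)` of norm and integral one that are almost
annihilated from the left by prescribed functions of integral zero. -/
theorem IsAmenableGroup.exists_norm_conv_lt (hG : IsAmenableGroup G μ) (S : Finset (Lp ℂ 1 μ))
    (hS : ∀ b ∈ S, augmentation μ b = 0) {ε : ℝ} (hε : 0 < ε) :
    ∃ g : Lp ℂ 1 μ, ‖g‖ ≤ 1 ∧ augmentation μ g = 1 ∧ ∀ b ∈ S, ‖l1Conv b g‖ < ε := by
  classical
  obtain ⟨m, hm1, hm, hinv⟩ := hG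
  let D : Lp ℂ 1 μ →L[ℂ] (S → Lp ℂ 1 μ) :=
    ContinuousLinearMap.pi fun b : S => isContractiveFamily_leftTranslateL.integ (b : Lp ℂ 1 μ)
  have hD : ∀ g b, D g b = l1Conv b.1 g := fun g b => rfl
  let P : Set (Lp ℂ 1 μ) := {g | ‖g‖ ≤ 1 ∧ augmentation μ g = 1}
  have hP : Convex ℝ P := by
    intro g hg h hh s t hs ht hst
    refine ⟨?_, ?_⟩
    · have := convex_closedBall (0 : Lp ℂ 1 μ) 1 (x := g) (by simpa using hg.1) (y := h)
        (by simpa using hh.1) hs ht hst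
      simpa using this
    · rw [map_add, ← algebraMap_smul ℂ s g, ← algebraMap_smul ℂ t h, map_smul, map_smul, hg.2, hh.2]
      simpa using congrArg (fun r : ℝ => (r : ℂ)) hst
  by_cases h0 : (0 : S → Lp ℂ 1 μ) ∈ closure (D '' P)
  · obtain ⟨_, ⟨g, hg, rfl⟩, hg'⟩ := Metric.mem_closure_iff.1 h0 ε hε
    refine ⟨g, hg.1, hg.2, fun b hb => ?_⟩
    rw [dist_zero_left] at hg'
    exact (norm_le_pi_norm (D g) ⟨b, hb⟩).trans_lt hg'
  exfalso
  have hconv : Convex ℝ (closure (D '' P)) :=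
    (hP.linear_image (D.restrictScalars ℝ).toLinearMap).closure
  obtain ⟨f, c, hf0, hf⟩ :=
    RCLike.geometric_hahn_banach_point_closed (𝕜 := ℂ) hconv isClosed_closure h0
  rw [map_zero, map_zero] at hf0
  obtain ⟨e, he, heφ, -⟩ := exists_left_approximate_unit (μ := μ) ∅ one_pos
  let ψ : S → (Lp ℂ 1 μ →L[ℂ] ℂ) := fun b =>
    f.comp (ContinuousLinearMap.single ℂ (fun _ : S => Lp ℂ 1 μ) b)
  -- At `x` this is the real part of the separating functional on the tuple of `b * (e * L_x e)`. As
  -- `e * L_x e` lies in `P`, it is at least `c > 0`, while the mean of each summand vanishes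
  -- because `χ(b * e) = 0`.
  let H : LInftyFun μ := ∑ b : S, LInftyFun.ofBounded μ (coefficient (ψ b) e (l1Conv b.1 e))
  have hH0 : m H = 0 := by
    rw [map_sum]
    refine Finset.sum_eq_zero fun b _ => mean_coefficient_eq_zero hm1 hm hinv _ _ _ ?_
    rw [augmentation_conv, hS b.1 b.2, zero_mul]
  have hHc : ∀ x, c ≤ H.1 x := by
    intro x
    have h1 : H.1 x = (f (D (l1Conv e (leftTranslate x e)))).re := by
      have hv : D (l1Conv e (leftTranslate x e)) =
          ∑ b, Pi.single b (D (l1Conv e (leftTranslate x e)) b) :=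
        (Finset.univ_sum_single _).symm
      rw [hv, map_sum, Complex.re_sum, AddSubmonoidClass.coe_finsetSum, Finset.sum_apply]
      refine Finset.sum_congr rfl fun b _ => ?_
      rw [hD, ← conv_assoc]
      rfl
    rw [h1]
    refine (hf _ (subset_closure ⟨_, ⟨?_, ?_⟩, rfl⟩)).le
    · refine (norm_conv_le _ _).trans ?_
      rw [norm_leftTranslate]
      exact mul_le_one₀ he (norm_nonneg _) he
    · rw [augmentation_conv, augmentation_leftTranslate, heφ, one_mul]
  have h2 := hm (H - c • LInftyFun.one μ) fun _ _ => ae_of_all _ fun x => by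
    change 0 ≤ H.1 x - c * 1
    linarith [hHc x]
  rw [map_sub, map_smul, hm1, hH0, smul_eq_mul, mul_one] at h2
  linarith

end Reiter

/-! ### Operators on the projective tensor square -/

namespace ProjTensorSq

section Maps

variable {A : Type*} [NonUnitalNormedRing A] [NormedSpace ℂ A]

theorem tmul_eq (a b : A) : (tmul a b : ProjTensorSq A) =
    ((PiTensorProduct.tprodL ℂ (![a, b] : Fin 2 → A) : ⨂[ℂ] _ : Fin 2, A) : ProjTensorSq A) := by
  rw [tmul]
  simp

theorem continuous_tmul : Continuous fun p : A × A => (tmul p.1 p.2 : ProjTensorSq A) := by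
  simp_rw [tmul_eq]
  refine (UniformSpace.Completion.continuous_coe _).comp
    ((PiTensorProduct.tprodL ℂ).cont.comp ?_)
  refine continuous_pi fun i => ?_
  fin_cases i
  · exact continuous_fst
  · exact continuous_snd

theorem norm_tmul_le (a b : A) : ‖(tmul a b : ProjTensorSq A)‖ ≤ ‖a‖ * ‖b‖ := by
  rw [tmul, UniformSpace.Completion.norm_coe]
  simpa using PiTensorProduct.projectiveSeminorm_tprod_le (𝕜 := ℂ) (![a, b] : Fin 2 → A)

/-- A closed additive property of elementary tensors holds on all of `A ⊗̂ A`. -/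
theorem induction_on {P : ProjTensorSq A → Prop} (s : ProjTensorSq A) (hP : IsClosed {s | P s})
    (hadd : ∀ s t, P s → P t → P (s + t)) (htmul : ∀ a b, P (tmul a b)) : P s := by
  induction s using UniformSpace.Completion.induction_on with
  | hp => exact hP
  | ih s =>
    induction s using PiTensorProduct.induction_on with
    | smul_tprod c m =>
      -- Scalars are absorbed into the first factor, so no closure under scalar multiplication has
      -- to be assumed.
      have h : c • PiTensorProduct.tprod ℂ m = PiTensorProduct.tprod ℂ ![c • m 0, m 1] := by
        have h1 := (PiTensorProduct.tprod ℂ).map_update_smul m 0 c (m 0)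
        rw [Function.update_eq_self] at h1
        rw [← h1]
        congr 1
        funext i
        fin_cases i <;> simp
      rw [h]
      exact htmul _ _
    | add x y hx hy =>
      rw [UniformSpace.Completion.coe_add]
      exact hadd _ _ hx hy

theorem ext_tmul {E : Type*} [NormedAddCommGroup E] [NormedSpace ℂ E]
    {S T : ProjTensorSq A →L[ℂ] E} (h : ∀ a b, S (tmul a b) = T (tmul a b)) : S = T := by
  refine ContinuousLinearMap.ext fun s => ?_
  induction s using ProjTensorSq.induction_on with
  | hP => exact isClosed_eq S.continuous T.continuous
  | hadd s t hs ht => rw [map_add, map_add, hs, ht]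
  | htmul a b => exact h a b

theorem norm_completion_apply_le {E F : Type*} [SeminormedAddCommGroup E] [NormedSpace ℂ E]
    [SeminormedAddCommGroup F] [NormedSpace ℂ F] (T : E →L[ℂ] F) (x : UniformSpace.Completion E) :
    ‖T.completion x‖ ≤ ‖T‖ * ‖x‖ := by
  induction x using UniformSpace.Completion.induction_on with
  | hp => exact isClosed_le (by fun_prop) (by fun_prop)
  | ih x =>
    rw [ContinuousLinearMap.completion_apply_coe, UniformSpace.Completion.norm_coe,
      UniformSpace.Completion.norm_coe]
    exact T.le_opNorm x

/-- The tensor product `S ⊗ T` of two operators, as an operator on `A ⊗̂ A`. -/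
def map (S T : A →L[ℂ] A) : ProjTensorSq A →L[ℂ] ProjTensorSq A :=
  (PiTensorProduct.mapL (![S, T] : Fin 2 → (A →L[ℂ] A))).completion

theorem map_tmul (S T : A →L[ℂ] A) (a b : A) : map S T (tmul a b) = tmul (S a) (T b) := by
  simp only [map, tmul, ContinuousLinearMap.completion_apply_coe]
  congr 1
  simp only [PiTensorProduct.mapL_apply, PiTensorProduct.map_tprod]
  congr 1
  funext i; fin_cases i <;> simp

theorem norm_map_apply_le (S T : A →L[ℂ] A) (s : ProjTensorSq A) :
    ‖map S T s‖ ≤ ‖S‖ * ‖T‖ * ‖s‖ := by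
  refine (norm_completion_apply_le _ s).trans ?_
  refine mul_le_mul_of_nonneg_right ((PiTensorProduct.opNorm_mapL _).trans_eq ?_) (norm_nonneg _)
  simp

theorem map_map (S S' T T' : A →L[ℂ] A) (s : ProjTensorSq A) :
    map S T (map S' T' s) = map (S ∘L S') (T ∘L T') s := by
  have : map S T ∘L map S' T' = map (S ∘L S') (T ∘L T') :=
    ext_tmul fun a b => by simp [map_tmul]
  rw [← this]
  rfl

theorem flip_map (S T : A →L[ℂ] A) (s : ProjTensorSq A) :
    flip (map S T s) = map T S (flip s) := by
  have : (flip ∘L map S T : ProjTensorSq A →L[ℂ] ProjTensorSq A) = map T S ∘L flip :=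
    ext_tmul fun a b => by simp [map_tmul, flip_tmul]
  exact congrArg (fun F : ProjTensorSq A →L[ℂ] ProjTensorSq A => F s) this

/-- The operator `a ↦ a ⊗ b`. -/
def tmulRight (b : A) : A →L[ℂ] ProjTensorSq A :=
  UniformSpace.Completion.toComplL ∘L
    (PiTensorProduct.tprodL ℂ).toContinuousLinearMap (![0, b] : Fin 2 → A) 0

theorem tmulRight_apply (a b : A) : tmulRight b a = tmul a b := by
  rw [tmul_eq]
  change ((PiTensorProduct.tprodL ℂ (Function.update (![0, b] : Fin 2 → A) 0 a) :
    ⨂[ℂ] _ : Fin 2, A) : ProjTensorSq A) = _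
  congr 2
  funext i; fin_cases i <;> simp

/-- The operator `b ↦ a ⊗ b`. -/
def tmulLeft (a : A) : A →L[ℂ] ProjTensorSq A :=
  UniformSpace.Completion.toComplL ∘L
    (PiTensorProduct.tprodL ℂ).toContinuousLinearMap (![a, 0] : Fin 2 → A) 1

theorem tmulLeft_apply (a b : A) : tmulLeft a b = tmul a b := by
  rw [tmul_eq]
  change ((PiTensorProduct.tprodL ℂ (Function.update (![a, 0] : Fin 2 → A) 1 b) :
    ⨂[ℂ] _ : Fin 2, A) : ProjTensorSq A) = _
  congr 2
  funext i; fin_cases i <;> simp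

variable {G : Type*} [TopologicalSpace G]

/-- Joint continuity of `⊗` gives continuous orbits for elementary tensors. The uniform bound by `1`
makes the set of tensors with continuous orbit closed. -/
theorem isContractiveFamily_map {L R : G → A →L[ℂ] A} (hL : IsContractiveFamily L)
    (hR : IsContractiveFamily R) : IsContractiveFamily fun z => map (L z) (R z) := by
  have hbound : ∀ z s, ‖map (L z) (R z) s‖ ≤ ‖s‖ := fun z s => by
    refine (norm_map_apply_le _ _ s).trans (mul_le_of_le_one_left (norm_nonneg _) ?_)
    refine mul_le_one₀ ?_ (norm_nonneg _) ?_
    · exact (L z).opNorm_le_bound zero_le_one fun x => by simpa using hL.norm_apply_le z x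
    · exact (R z).opNorm_le_bound zero_le_one fun x => by simpa using hR.norm_apply_le z x
  refine ⟨hbound, fun s => ?_⟩
  induction s using ProjTensorSq.induction_on with
  | hP =>
    refine isClosed_of_closure_subset fun s hs => continuous_iff_continuousAt.2 fun z₀ => ?_
    refine Metric.tendsto_nhds.2 fun ε hε => ?_
    obtain ⟨t, ht, hst⟩ := Metric.mem_closure_iff.1 hs (ε / 3) (by positivity)
    have htc : Continuous fun z => map (L z) (R z) t := ht
    filter_upwards [Metric.tendsto_nhds.1 (htc.tendsto z₀) (ε / 3) (by positivity)] with z hz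
    rw [dist_eq_norm] at hst hz ⊢
    have h1 : map (L z) (R z) s - map (L z₀) (R z₀) s = map (L z) (R z) (s - t) +
        (map (L z) (R z) t - map (L z₀) (R z₀) t) - map (L z₀) (R z₀) (s - t) := by
      rw [map_sub, map_sub]; abel
    rw [h1]
    refine (norm_sub_le _ _).trans_lt ?_
    have h2 := norm_add_le (map (L z) (R z) (s - t)) (map (L z) (R z) t - map (L z₀) (R z₀) t)
    linarith [hbound z (s - t), hbound z₀ (s - t)]
  | hadd s t hs ht =>
    simp only [map_add]
    exact Continuous.add hs ht
  | htmul a b =>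
    simp_rw [map_tmul]
    exact continuous_tmul.comp ((hL.continuous_apply a).prodMk (hR.continuous_apply b))

end Maps

end ProjTensorSq

namespace IsContractiveFamily

variable {G : Type*} [TopologicalSpace G] {E : Type*} [NormedAddCommGroup E] [NormedSpace ℂ E]

theorem id : IsContractiveFamily fun _ : G => ContinuousLinearMap.id ℂ E :=
  ⟨fun _ _ => le_rfl, fun _ => continuous_const⟩

theorem comp_inv [Group G] [ContinuousInv G] {T : G → E →L[ℂ] E} (hT : IsContractiveFamily T) :
    IsContractiveFamily fun z => T z⁻¹ :=
  ⟨fun z => hT.norm_apply_le z⁻¹, fun x => (hT.continuous_apply x).comp continuous_inv⟩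

end IsContractiveFamily

/-! ### The outer and inner actions of `G` on the tensor square of `L¹(G)` -/

namespace GroupL1

variable {G : Type*} [Group G] [TopologicalSpace G] [IsTopologicalGroup G]
  [MeasurableSpace G] [BorelSpace G] [LocallyCompactSpace G] [T2Space G]
  {μ : Measure G} [μ.IsHaarMeasure] [μ.Regular]

/-- An element of the group algebra as an element of the underlying space `L¹(G)`. -/
def toLp (a : GroupL1 G μ) : Lp ℂ 1 μ := a

variable (μ) in
/-- Left translation `a ↦ δ_y * a` of the group algebra. -/
def left (y : G) : GroupL1 G μ →L[ℂ] GroupL1 G μ := leftTranslateL μ y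

variable (μ) in
/-- Right translation `a ↦ a * δ_w` of the group algebra. -/
def right (w : G) : GroupL1 G μ →L[ℂ] GroupL1 G μ := rightTranslateL μ w

theorem isContractiveFamily_left : IsContractiveFamily (left μ) :=
  isContractiveFamily_leftTranslateL (μ := μ)

theorem isContractiveFamily_right : IsContractiveFamily (right μ) :=
  isContractiveFamily_rightTranslateL (μ := μ)

theorem left_mul (y z : G) : left μ (y * z) = left μ y ∘L left μ z :=
  ContinuousLinearMap.ext fun a => leftTranslate_mul (μ := μ) y z a

theorem right_mul (y z : G) : right μ (y * z) = right μ z ∘L right μ y :=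
  ContinuousLinearMap.ext fun a => rightTranslateL_mul (μ := μ) y z a

theorem right_comp_left (w y : G) : right μ w ∘L left μ y = left μ y ∘L right μ w :=
  ContinuousLinearMap.ext fun a => rightTranslateL_leftTranslate (μ := μ) w y a

theorem left_apply_mul (y : G) (a b : GroupL1 G μ) : left μ y a * b = left μ y (a * b) :=
  conv_leftTranslate (μ := μ) y a b

theorem right_apply_mul (w : G) (a b : GroupL1 G μ) : right μ w a * b = a * left μ w b :=
  rightTranslateL_conv (μ := μ) w a b

theorem mul_eq_integ_left (a b : GroupL1 G μ) :
    a * b = (isContractiveFamily_left (μ := μ)).integ (toLp a) b := rfl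

theorem mul_eq_integ_right (a b : GroupL1 G μ) :
    a * b = (isContractiveFamily_right (μ := μ)).integ (toLp b) a :=
  conv_eq_integ_right (μ := μ) a b

theorem left_one (a : GroupL1 G μ) : left μ 1 a = a := by
  refine Lp.ext (p := 1) (μ := μ) ?_
  filter_upwards [coeFn_leftTranslate (μ := μ) 1 a] with x hx
  refine hx.trans ?_
  rw [inv_one, one_mul]

theorem left_left_inv (y : G) (a : GroupL1 G μ) : left μ y (left μ y⁻¹ a) = a := by
  rw [← ContinuousLinearMap.comp_apply, ← left_mul, mul_inv_cancel, left_one]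

open ProjTensorSq

variable (μ) in
/-- The family `δ_z ⊗ δ_{z⁻¹}` acting on the outer sides of `A ⊗̂ A`. -/
def outer (z : G) : ProjTensorSq (GroupL1 G μ) →L[ℂ] ProjTensorSq (GroupL1 G μ) :=
  ProjTensorSq.map (left μ z) (right μ z⁻¹)

variable (μ) in
/-- The family `δ_{z⁻¹} ⊗ δ_z` acting on the inner sides of `A ⊗̂ A`. -/
def inner (z : G) : ProjTensorSq (GroupL1 G μ) →L[ℂ] ProjTensorSq (GroupL1 G μ) :=
  ProjTensorSq.map (right μ z⁻¹) (left μ z)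

theorem isContractiveFamily_outer : IsContractiveFamily (outer μ) :=
  isContractiveFamily_map isContractiveFamily_left isContractiveFamily_right.comp_inv

theorem isContractiveFamily_inner : IsContractiveFamily (inner μ) :=
  isContractiveFamily_map isContractiveFamily_right.comp_inv isContractiveFamily_left

/-- In each tensor factor one action translates on the left and the other on the right. -/
theorem outer_inner_comm (z y : G) (s : ProjTensorSq (GroupL1 G μ)) :
    outer μ z (inner μ y s) = inner μ y (outer μ z s) := by
  rw [outer, inner, ProjTensorSq.map_map, ProjTensorSq.map_map, right_comp_left, right_comp_left]

variable (μ) in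
/-- The average `∫ f(z) (δ_z ⊗ δ_{z⁻¹}) dz` of the outer action. -/
def outerAvg (f : Lp ℂ 1 μ) : ProjTensorSq (GroupL1 G μ) →L[ℂ] ProjTensorSq (GroupL1 G μ) :=
  (isContractiveFamily_outer (μ := μ)).integ f

variable (μ) in
/-- The average `∫ f(z) (δ_{z⁻¹} ⊗ δ_z) dz` of the inner action. -/
def innerAvg (f : Lp ℂ 1 μ) : ProjTensorSq (GroupL1 G μ) →L[ℂ] ProjTensorSq (GroupL1 G μ) :=
  (isContractiveFamily_inner (μ := μ)).integ f

theorem flip_outerAvg (f : Lp ℂ 1 μ) (s : ProjTensorSq (GroupL1 G μ)) :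
    flip (outerAvg μ f s) = innerAvg μ f (flip s) :=
  IsContractiveFamily.map_integ_of_intertwine _ _ ProjTensorSq.flip (fun _ x => flip_map _ _ x) f s

theorem flip_innerAvg (f : Lp ℂ 1 μ) (s : ProjTensorSq (GroupL1 G μ)) :
    flip (innerAvg μ f s) = outerAvg μ f (flip s) :=
  IsContractiveFamily.map_integ_of_intertwine _ _ ProjTensorSq.flip (fun _ x => flip_map _ _ x) f s

theorem outerAvg_innerAvg_comm (f : Lp ℂ 1 μ) (s : ProjTensorSq (GroupL1 G μ)) :
    outerAvg μ f (innerAvg μ f s) = innerAvg μ f (outerAvg μ f s) :=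
  IsContractiveFamily.map_integ_of_intertwine _ _ (outerAvg μ f) (fun y x =>
    (IsContractiveFamily.map_integ_of_intertwine _ _ (inner μ y)
      (fun z x => (outer_inner_comm z y x).symm) f x).symm) f s

/-- Averaging the square `u ⊗ u` over both actions gives a symmetric tensor. -/
theorem flip_outerAvg_innerAvg_tmul (f : Lp ℂ 1 μ) (u : GroupL1 G μ) :
    flip (outerAvg μ f (innerAvg μ f (tmul u u))) = outerAvg μ f (innerAvg μ f (tmul u u)) := by
  rw [flip_outerAvg, flip_innerAvg, flip_tmul, outerAvg_innerAvg_comm]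

/-- Expressing the module action through translations lets the commutator with `a` be estimated one
translation at a time. Both sides are continuous and linear in `s`, so elementary tensors suffice,
where `b ↦ b ⊗ c` intertwines the two families. -/
theorem leftMul_eq_integ (a : GroupL1 G μ) (s : ProjTensorSq (GroupL1 G μ)) :
    leftMul a s = (isContractiveFamily_map (isContractiveFamily_left (μ := μ))
      IsContractiveFamily.id).integ (toLp a) s := by
  refine congrArg (fun F : ProjTensorSq (GroupL1 G μ) →L[ℂ] ProjTensorSq (GroupL1 G μ) => F s)
    (ext_tmul fun b c => ?_)
  rw [leftMul_tmul, mul_eq_integ_left, ← tmulRight_apply, ← tmulRight_apply]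
  refine IsContractiveFamily.map_integ_of_intertwine _ _ _ (fun y x => ?_) _ _
  rw [tmulRight_apply, tmulRight_apply, map_tmul, ContinuousLinearMap.id_apply]

theorem rightMul_eq_integ (a : GroupL1 G μ) (s : ProjTensorSq (GroupL1 G μ)) :
    rightMul a s = (isContractiveFamily_map IsContractiveFamily.id
      (isContractiveFamily_right (μ := μ))).integ (toLp a) s := by
  refine congrArg (fun F : ProjTensorSq (GroupL1 G μ) →L[ℂ] ProjTensorSq (GroupL1 G μ) => F s)
    (ext_tmul fun b c => ?_)
  rw [rightMul_tmul, mul_eq_integ_right, ← tmulLeft_apply, ← tmulLeft_apply]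
  refine IsContractiveFamily.map_integ_of_intertwine _ _ _ (fun y x => ?_) _ _
  rw [tmulLeft_apply, tmulLeft_apply, map_tmul, ContinuousLinearMap.id_apply]

/-- Pointwise `(δ_w ⊗ 1) outer(z) = (1 ⊗ δ_w) outer(wz)`, the second factor being multiplied on the
right; substituting `z ↦ w⁻¹ z` transfers the shift to `f`. -/
theorem map_left_id_outerAvg (w : G) (f : Lp ℂ 1 μ) (s : ProjTensorSq (GroupL1 G μ)) :
    map (left μ w) (ContinuousLinearMap.id ℂ _) (outerAvg μ f s) =
      map (ContinuousLinearMap.id ℂ _) (right μ w) (outerAvg μ (leftTranslate w f) s) := by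
  rw [outerAvg, outerAvg, IsContractiveFamily.map_integ, IsContractiveFamily.map_integ,
    ← integral_mul_left_eq_self (fun z => leftTranslate w f z • _) w]
  refine integral_congr_ae ?_
  filter_upwards [(measurePreserving_mul_left μ w).quasiMeasurePreserving.ae
    (coeFn_leftTranslate w f)] with z hz
  rw [hz, inv_mul_cancel_left]
  simp only [outer, ProjTensorSq.map_map, ContinuousLinearMap.id_comp, ← left_mul, ← right_mul]
  simp

theorem norm_outerAvg_apply_le (f : Lp ℂ 1 μ) (s : ProjTensorSq (GroupL1 G μ)) :
    ‖outerAvg μ f s‖ ≤ ‖f‖ * ‖s‖ := IsContractiveFamily.norm_integ_apply_le _ f s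

theorem norm_innerAvg_apply_le (f : Lp ℂ 1 μ) (s : ProjTensorSq (GroupL1 G μ)) :
    ‖innerAvg μ f s‖ ≤ ‖f‖ * ‖s‖ := IsContractiveFamily.norm_integ_apply_le _ f s

theorem integrable_norm_mul_norm_leftTranslate_sub (a f : Lp ℂ 1 μ) :
    Integrable (fun w => ‖a w‖ * ‖leftTranslate w f - f‖) μ := by
  have h := (integrable_smul_of_continuous a (k := fun w => leftTranslate w f - f)
    ((continuous_leftTranslate f).sub continuous_const) (C := ‖f‖ + ‖f‖) (fun w =>
      (norm_sub_le _ _).trans_eq (by rw [norm_leftTranslate]))).norm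
  simpa only [norm_smul] using h

/-- By `map_left_id_outerAvg` the commutator equals `∫ a(w) (1 ⊗ δ_w) (outerAvg (L_w f - f) s) dw`.
-/
theorem norm_leftMul_sub_rightMul_outerAvg_le (a : GroupL1 G μ) (f : Lp ℂ 1 μ)
    (s : ProjTensorSq (GroupL1 G μ)) :
    ‖leftMul a (outerAvg μ f s) - rightMul a (outerAvg μ f s)‖ ≤
      (∫ w, ‖toLp a w‖ * ‖leftTranslate w f - f‖ ∂μ) * ‖s‖ := by
  have hL := isContractiveFamily_map (isContractiveFamily_left (μ := μ))
    (IsContractiveFamily.id (G := G) (E := GroupL1 G μ))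
  have hR := isContractiveFamily_map (IsContractiveFamily.id (G := G) (E := GroupL1 G μ))
    (isContractiveFamily_right (μ := μ))
  rw [leftMul_eq_integ, rightMul_eq_integ, IsContractiveFamily.integ_apply,
    IsContractiveFamily.integ_apply, ← integral_sub (hL.integrable _ _) (hR.integrable _ _), ← integral_mul_const]
  refine norm_integral_le_of_norm_le
    ((integrable_norm_mul_norm_leftTranslate_sub (toLp a) f).mul_const _) (ae_of_all _ fun w => ?_)
  rw [map_left_id_outerAvg, ← smul_sub, ← map_sub, outerAvg, outerAvg,
    ← IsContractiveFamily.integ_sub, norm_smul, mul_assoc]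
  refine mul_le_mul_of_nonneg_left ((hR.norm_apply_le w _).trans ?_) (norm_nonneg _)
  exact norm_outerAvg_apply_le _ _

/-- The outer action conjugates the product. Multiplying by `a` turns the trailing right translation
by `z⁻¹` into a left translate of `a`. -/
theorem prod_outer_mul (z : G) (s : ProjTensorSq (GroupL1 G μ)) (a : GroupL1 G μ) :
    prod (outer μ z s) * a = left μ z (prod s * left μ z⁻¹ a) := by
  have h : (ContinuousLinearMap.mul ℂ (GroupL1 G μ)).flip a ∘L prod ∘L outer μ z =
      left μ z ∘L (ContinuousLinearMap.mul ℂ (GroupL1 G μ)).flip (left μ z⁻¹ a) ∘L prod := by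
    refine ext_tmul fun b c => ?_
    change prod (outer μ z (tmul b c)) * a = left μ z (prod (tmul b c) * left μ z⁻¹ a)
    rw [outer, map_tmul, prod_tmul, prod_tmul, mul_assoc, right_apply_mul, left_apply_mul,
      mul_assoc]
  exact congrArg (fun F : ProjTensorSq (GroupL1 G μ) →L[ℂ] GroupL1 G μ => F s) h

/-- The translations by `y⁻¹` and `y` meet in the middle of the product and cancel. -/
theorem prod_inner (y : G) (s : ProjTensorSq (GroupL1 G μ)) : prod (inner μ y s) = prod s := by
  have h : prod ∘L inner μ y = (prod : ProjTensorSq (GroupL1 G μ) →L[ℂ] GroupL1 G μ) := by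
    refine ext_tmul fun b c => ?_
    rw [ContinuousLinearMap.comp_apply, inner, map_tmul, prod_tmul, prod_tmul, right_apply_mul]
    congr 1
    simpa using left_left_inv y⁻¹ c
  exact congrArg (fun F : ProjTensorSq (GroupL1 G μ) →L[ℂ] GroupL1 G μ => F s) h

theorem prod_innerAvg (f : Lp ℂ 1 μ) (s : ProjTensorSq (GroupL1 G μ)) :
    prod (innerAvg μ f s) = augmentation μ f • prod s := by
  rw [innerAvg, IsContractiveFamily.map_integ]
  simp_rw [prod_inner]
  rw [integral_smul_const, augmentation_apply]

/-- Since `∫ f = 1`, also `a = ∫ f(z) δ_z * (δ_{z⁻¹} * a) dz`. The difference with `prod_outer_mul`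
is then estimated under the integral, where `δ_z` is contractive. -/
theorem norm_prod_outerAvg_mul_sub_le {f : Lp ℂ 1 μ} (hf : augmentation μ f = 1)
    (s : ProjTensorSq (GroupL1 G μ)) (a : GroupL1 G μ) :
    ‖prod (outerAvg μ f s) * a - a‖ ≤
      ∫ z, ‖f z‖ * ‖prod s * left μ z⁻¹ a - left μ z⁻¹ a‖ ∂μ := by
  let T : GroupL1 G μ →L[ℂ] GroupL1 G μ :=
    ContinuousLinearMap.mul ℂ _ (prod s) - ContinuousLinearMap.id ℂ _
  have hT : ∀ x, T x = prod s * x - x := fun x => rfl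
  have hc : ∀ x : GroupL1 G μ, Continuous fun z : G => left μ z⁻¹ x := fun x =>
    (isContractiveFamily_left.comp_inv).continuous_apply x
  have hb : ∀ z : G, ‖T (left μ z⁻¹ a)‖ ≤ ‖T‖ * ‖a‖ := fun z => (T.le_opNorm _).trans
    (mul_le_mul_of_nonneg_left (isContractiveFamily_left.norm_apply_le _ _) (norm_nonneg _))
  have hInt : Integrable (fun z => ‖f z‖ * ‖T (left μ z⁻¹ a)‖) μ := by
    have := (integrable_smul_of_continuous f (T.continuous.comp (hc a)) hb).norm
    simpa only [norm_smul, Function.comp_apply] using this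
  have h1 : prod (outerAvg μ f s) * a =
      ∫ z, f z • left μ z (prod s * left μ z⁻¹ a) ∂μ := by
    have := (isContractiveFamily_outer (μ := μ)).map_integ
      ((ContinuousLinearMap.mul ℂ (GroupL1 G μ)).flip a ∘L prod) f s
    refine this.trans (integral_congr_ae (ae_of_all _ fun z => ?_))
    exact congrArg (fun x => f z • x) (prod_outer_mul z s a)
  have hi1 : Integrable (fun z => f z • left μ z (prod s * left μ z⁻¹ a)) μ := by
    simp_rw [← prod_outer_mul]
    let P : ProjTensorSq (GroupL1 G μ) →L[ℂ] GroupL1 G μ :=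
      (ContinuousLinearMap.mul ℂ (GroupL1 G μ)).flip a ∘L prod
    exact (P.integrable_comp ((isContractiveFamily_outer (μ := μ)).integrable f s)).congr
      (ae_of_all _ fun z => P.map_smul (f z) (outer μ z s))
  have h2 : a = ∫ z, f z • a ∂μ := by
    rw [integral_smul_const, ← augmentation_apply, hf, one_smul]
  have hi2 : Integrable (fun z => f z • a) μ := (L1.integrable_coeFn f).smul_const a
  calc ‖prod (outerAvg μ f s) * a - a‖
      = ‖∫ z, (f z • left μ z (prod s * left μ z⁻¹ a) - f z • a) ∂μ‖ := by
        rw [integral_sub hi1 hi2, ← h1, ← h2]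
    _ ≤ ∫ z, ‖f z‖ * ‖T (left μ z⁻¹ a)‖ ∂μ := by
        refine norm_integral_le_of_norm_le hInt (ae_of_all _ fun z => ?_)
        rw [← smul_sub, norm_smul]
        refine mul_le_mul_of_nonneg_left ?_ (norm_nonneg _)
        nth_rewrite 2 [← left_left_inv z a]
        rw [← map_sub, hT]
        exact isContractiveFamily_left.norm_apply_le _ _

end GroupL1

/-! ### Construction of the symmetric approximate diagonal -/

section SymmetricDiagonal

variable {G : Type*} [Group G] [TopologicalSpace G] [IsTopologicalGroup G]
  [MeasurableSpace G] [BorelSpace G] [LocallyCompactSpace G] [T2Space G]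
  {μ : Measure G} [μ.IsHaarMeasure] [μ.Regular]

theorem Finset.exists_pos_le {α : Type*} (S : Finset α) {δ : α → ℝ} (hδ : ∀ a, 0 < δ a) :
    ∃ d, 0 < d ∧ ∀ a ∈ S, d ≤ δ a := by
  rcases S.eq_empty_or_nonempty with rfl | hS
  · exact ⟨1, one_pos, by simp⟩
  · obtain ⟨a, -, ha⟩ := S.exists_min_image δ hS
    exact ⟨δ a, hδ a, ha⟩

theorem norm_convRightL_le (g : Lp ℂ 1 μ) : ‖convRightL g‖ ≤ ‖g‖ :=
  LinearMap.mkContinuous_norm_le _ (norm_nonneg _) _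

/-- On an amenable group there is a function of norm and integral one that is almost left invariant
in mean with respect to finitely many given integrable densities. -/
theorem IsAmenableGroup.exists_integral_norm_leftTranslate_sub_lt (hG : IsAmenableGroup G μ)
    (S : Finset (Lp ℂ 1 μ)) {ε : ℝ} (hε : 0 < ε) :
    ∃ f : Lp ℂ 1 μ, ‖f‖ ≤ 1 ∧ augmentation μ f = 1 ∧
      ∀ a ∈ S, ∫ w, ‖a w‖ * ‖leftTranslate w f - f‖ ∂μ < ε := by
  classical
  obtain ⟨e, he, heφ, -⟩ := exists_left_approximate_unit (μ := μ) ∅ one_pos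
  have hk : Continuous fun w : G => leftTranslate w e - e :=
    (continuous_leftTranslate e).sub continuous_const
  have hkb : ∀ w : G, ‖leftTranslate w e - e‖ ≤ ‖e‖ + ‖e‖ := fun w =>
    (norm_sub_le _ _).trans_eq (by rw [norm_leftTranslate])
  -- With `f = e * g` one has `L_w f - f = (L_w e - e) * g`, and `w ↦ L_w e - e` is continuous.
  -- Smallness for the finitely many `w` in `W a` therefore gives smallness in mean over all `w`.
  choose W δ hδ hW using fun a : Lp ℂ 1 μ => exists_finset_integral_lt a hk hkb hε
  obtain ⟨d, hd, hdδ⟩ := S.exists_pos_le hδ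
  obtain ⟨g, hg, hgφ, hgS⟩ := hG.exists_norm_conv_lt
    (S.biUnion fun a => (W a).image fun w => leftTranslate w e - e) (fun b hb => by
      simp only [Finset.mem_biUnion, Finset.mem_image] at hb
      obtain ⟨_, _, w, _, rfl⟩ := hb
      rw [map_sub, augmentation_leftTranslate, sub_self]) hd
  refine ⟨l1Conv e g, (norm_conv_le e g).trans (mul_le_one₀ he (norm_nonneg _) hg), ?_,
    fun a ha => ?_⟩
  · rw [augmentation_conv, heφ, hgφ, one_mul]
  · have h := hW a (convRightL g) ((norm_convRightL_le g).trans (hg.trans one_le_two))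
      fun w hw => (hgS _ (Finset.mem_biUnion.2 ⟨a, ha, Finset.mem_image_of_mem _ hw⟩)).trans_le
        (hdδ a ha)
    refine lt_of_eq_of_lt (integral_congr_ae (ae_of_all _ fun w => ?_)) h
    change ‖a w‖ * ‖leftTranslate w (l1Conv e g) - l1Conv e g‖ =
      ‖a w‖ * ‖convRightL g (leftTranslate w e - e)‖
    rw [map_sub, ← conv_leftTranslate]
    rfl

namespace GroupL1

open ProjTensorSq

variable (μ) in
/-- The augmentation character of the group algebra. -/
def aug : GroupL1 G μ →L[ℂ] ℂ := augmentation μ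

theorem aug_mul (a b : GroupL1 G μ) : aug μ (a * b) = aug μ a * aug μ b :=
  augmentation_conv (μ := μ) a b

/-- Approximate units of the group algebra work in mean over the translates of an element. -/
theorem exists_approximate_unit_integral_lt (f : Lp ℂ 1 μ) (S : Finset (GroupL1 G μ))
    {ε : ℝ} (hε : 0 < ε) :
    ∃ u : GroupL1 G μ, ‖u‖ ≤ 1 ∧ ∀ a ∈ S,
      ∫ z, ‖f z‖ * ‖u * u * left μ z⁻¹ a - left μ z⁻¹ a‖ ∂μ < ε := by
  classical
  have hc : ∀ a : GroupL1 G μ, Continuous fun z : G => left μ z⁻¹ a := fun a =>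
    isContractiveFamily_left.comp_inv.continuous_apply a
  have hb : ∀ (a : GroupL1 G μ) (z : G), ‖left μ z⁻¹ a‖ ≤ ‖a‖ := fun a z =>
    isContractiveFamily_left.norm_apply_le _ _
  choose Z δ hδ hZ using fun a : GroupL1 G μ => exists_finset_integral_lt f (hc a) (hb a) hε
  obtain ⟨d, hd, hdδ⟩ := S.exists_pos_le hδ
  -- The tolerance is `d / 2` because `u² x - x = u (u x - x) + (u x - x)` uses it twice.
  obtain ⟨u, hu, -, huS⟩ : ∃ u : GroupL1 G μ, ‖u‖ ≤ 1 ∧ aug μ u = 1 ∧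
      ∀ b ∈ S.biUnion fun a => (Z a).image fun z => left μ z⁻¹ a, ‖u * b - b‖ < d / 2 :=
    exists_left_approximate_unit (μ := μ) _ (half_pos hd)
  refine ⟨u, hu, fun a ha => ?_⟩
  let T : GroupL1 G μ →L[ℂ] GroupL1 G μ :=
    ContinuousLinearMap.mul ℂ _ (u * u) - ContinuousLinearMap.id ℂ _
  have huu : ‖u * u‖ ≤ 1 := (norm_mul_le u u).trans (mul_le_one₀ hu (norm_nonneg _) hu)
  have hT : ‖T‖ ≤ 2 := by
    refine T.opNorm_le_bound zero_le_two fun x => ?_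
    change ‖u * u * x - x‖ ≤ 2 * ‖x‖
    refine (norm_sub_le _ _).trans ?_
    have := (norm_mul_le (u * u) x).trans (mul_le_of_le_one_left (norm_nonneg x) huu)
    linarith
  refine hZ a T hT fun z hz => ?_
  have h1 := huS _ (Finset.mem_biUnion.2 ⟨a, ha, Finset.mem_image_of_mem _ hz⟩)
  set x := left μ z⁻¹ a
  have h2 : T x = u * (u * x - x) + (u * x - x) := by
    change u * u * x - x = _
    rw [mul_sub, mul_assoc]
    abel
  have h3 : ‖u * (u * x - x)‖ ≤ ‖u * x - x‖ :=
    (norm_mul_le _ _).trans (mul_le_of_le_one_left (norm_nonneg _) hu)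
  rw [h2]
  refine (norm_add_le _ _).trans_lt ?_
  linarith [hdδ a ha]

/-- On an amenable group there are symmetric tensors that are approximately diagonal for finitely
many elements of the group algebra. -/
theorem exists_symmetric_approximately_diagonal (hG : IsAmenableGroup G μ)
    (S : Finset (GroupL1 G μ)) {ε : ℝ} (hε : 0 < ε) :
    ∃ t : ProjTensorSq (GroupL1 G μ), flip t = t ∧ ∀ a ∈ S,
      ‖leftMul a t - rightMul a t‖ < ε ∧ ‖prod t * a - a‖ < ε := by
  obtain ⟨f, hf, hfφ, hfS⟩ : ∃ f : Lp ℂ 1 μ, ‖f‖ ≤ 1 ∧ augmentation μ f = 1 ∧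
      ∀ a ∈ S, ∫ w, ‖toLp a w‖ * ‖leftTranslate w f - f‖ ∂μ < ε :=
    hG.exists_integral_norm_leftTranslate_sub_lt S hε
  -- The order of choices matters: `u` must handle the translates of `a` weighted by `f`, while the
  -- commutator bound uses only `‖u‖ ≤ 1`.
  obtain ⟨u, hu, huS⟩ := exists_approximate_unit_integral_lt f S hε
  refine ⟨outerAvg μ f (innerAvg μ f (tmul u u)), flip_outerAvg_innerAvg_tmul f u,
    fun a ha => ⟨?_, ?_⟩⟩
  · refine (norm_leftMul_sub_rightMul_outerAvg_le a f _).trans_lt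
      (lt_of_le_of_lt (mul_le_of_le_one_right ?_ ?_) (hfS a ha))
    · exact integral_nonneg fun w => by positivity
    · refine (norm_innerAvg_apply_le f _).trans (mul_le_one₀ hf (norm_nonneg _) ?_)
      exact (norm_tmul_le u u).trans (mul_le_one₀ hu (norm_nonneg _) hu)
  · refine (norm_prod_outerAvg_mul_sub_le hfφ _ a).trans_lt ?_
    rw [prod_innerAvg, hfφ, one_smul, prod_tmul]
    exact huS a ha

/-- The net is indexed by a finite set of elements to be handled together with a tolerance `1 / (n +
1)`. -/
theorem isSymmetricallyPseudoAmenable_of_isAmenableGroup (hG : IsAmenableGroup G μ) :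
    IsSymmetricallyPseudoAmenable (GroupL1 G μ) := by
  classical
  choose t ht hdiag using fun i : Finset (GroupL1 G μ) × ℕ =>
    exists_symmetric_approximately_diagonal hG i.1 (ε := 1 / ((i.2 : ℝ) + 1)) (by positivity)
  refine ⟨Finset (GroupL1 G μ) × ℕ, inferInstance, inferInstance, inferInstance, t, fun a => ?_, ht⟩
  have hsmall : ∀ ε > 0, ∀ᶠ i : Finset (GroupL1 G μ) × ℕ in atTop,
      a ∈ i.1 ∧ 1 / ((i.2 : ℝ) + 1) < ε := by
    intro ε hε
    obtain ⟨n, hn⟩ := exists_nat_one_div_lt hε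
    filter_upwards [eventually_ge_atTop (({a}, n) : Finset (GroupL1 G μ) × ℕ)] with i hi
    refine ⟨hi.1 (Finset.mem_singleton_self a), lt_of_le_of_lt ?_ hn⟩
    have : (n : ℝ) ≤ i.2 := by exact_mod_cast hi.2
    gcongr
  refine ⟨Metric.tendsto_nhds.2 fun ε hε => ?_, Metric.tendsto_nhds.2 fun ε hε => ?_⟩
  · filter_upwards [hsmall ε hε] with i hi
    rw [dist_zero_right]
    exact (hdiag i a hi.1).1.trans hi.2
  · filter_upwards [hsmall ε hε] with i hi
    rw [dist_eq_norm]
    exact (hdiag i a hi.1).2.trans hi.2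

end GroupL1

end SymmetricDiagonal

/-! ### Slicing a tensor by a character -/

namespace ProjTensorSq

variable {A : Type*} [NonUnitalNormedRing A] [NormedSpace ℂ A] [CompleteSpace A]

/-- The slice map `A ⊗̂ A → A`, `a ⊗ b ↦ χ(b) a`, of a functional `χ`. -/
def slice (χ : A →L[ℂ] ℂ) : ProjTensorSq A →L[ℂ] A :=
  (PiTensorProduct.liftIsometry ℂ (fun _ : Fin 2 => A) A (MultilinearMap.mkContinuous
    { toFun := fun m => χ (m 1) • m 0
      map_update_add' := by
        intro _ m i x y
        fin_cases i <;> simp [Function.update, add_smul]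
      map_update_smul' := by
        intro _ m i c x
        fin_cases i <;> simp [Function.update, smul_smul, mul_comm] }
    ‖χ‖ (fun m => by
      simp only [MultilinearMap.coe_mk, norm_smul, Fin.prod_univ_two]
      rw [mul_comm ‖m 0‖, ← mul_assoc]
      exact mul_le_mul_of_nonneg_right (χ.le_opNorm _) (norm_nonneg _)))).fromCompletion

theorem slice_tmul (χ : A →L[ℂ] ℂ) (a b : A) : slice χ (tmul a b) = χ b • a := by
  simp [slice, tmul]

variable [IsScalarTower ℂ A A] [SMulCommClass ℂ A A]

theorem slice_leftMul (χ : A →L[ℂ] ℂ) (a : A) (s : ProjTensorSq A) :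
    slice χ (leftMul a s) = a * slice χ s := by
  have h : slice χ ∘L leftMul a = ContinuousLinearMap.mul ℂ A a ∘L slice χ := by
    refine ext_tmul fun b c => ?_
    simp [leftMul_tmul, slice_tmul]
  exact congrArg (fun F : ProjTensorSq A →L[ℂ] A => F s) h

/-- Multiplicativity of `χ` turns the right action, which lives in the sliced factor, into a scalar.
-/
theorem slice_rightMul {χ : A →L[ℂ] ℂ} (hχ : ∀ a b, χ (a * b) = χ a * χ b) (a : A)
    (s : ProjTensorSq A) : slice χ (rightMul a s) = χ a • slice χ s := by
  have h : slice χ ∘L rightMul a = χ a • slice χ := by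
    refine ext_tmul fun b c => ?_
    simp [rightMul_tmul, slice_tmul, hχ, mul_smul, smul_comm (χ a)]
  exact congrArg (fun F : ProjTensorSq A →L[ℂ] A => F s) h

theorem apply_slice {χ : A →L[ℂ] ℂ} (hχ : ∀ a b, χ (a * b) = χ a * χ b) (s : ProjTensorSq A) :
    χ (slice χ s) = χ (prod s) := by
  have h : χ ∘L slice χ = χ ∘L prod := by
    refine ext_tmul fun b c => ?_
    simp [prod_tmul, slice_tmul, hχ, mul_comm]
  exact congrArg (fun F : ProjTensorSq A →L[ℂ] ℂ => F s) h

end ProjTensorSq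

/-! ### From an approximate diagonal to an invariant mean -/

section Mean

set_option linter.unusedSectionVars false

section Pairing

variable {G : Type*} [TopologicalSpace G] [MeasurableSpace G] [BorelSpace G] [T2Space G]
  [LocallyCompactSpace G] {μ : Measure G} [μ.Regular]

/-- A property that holds locally almost everywhere holds almost everywhere on the set where an
integrable function does not vanish. -/
theorem ae_eq_zero_or_of_locally_ae {F : Type*} [NormedAddCommGroup F] [NormedSpace ℝ F]
    {f : G → F} (hf : Integrable f μ) {p : G → Prop}
    (hp : ∀ K : Set G, IsCompact K → ∀ᵐ x ∂(μ.restrict K), p x) : ∀ᵐ x ∂μ, f x = 0 ∨ p x := by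
  obtain ⟨K, hK, hf0⟩ := exists_isCompact_seq_ae_eq_zero hf
  have hKp : ∀ᵐ x ∂(μ.restrict (⋃ n, K n)), p x :=
    (ae_restrict_iUnion_iff _ _).2 fun n => hp _ (hK n)
  have hm : MeasurableSet (⋃ n, K n) := MeasurableSet.iUnion fun n => (hK n).measurableSet
  rw [ae_restrict_iff' hm] at hKp
  rw [ae_restrict_iff' hm.compl] at hf0
  filter_upwards [hKp, hf0] with x h1 h2
  by_cases hx : x ∈ ⋃ n, K n
  · exact Or.inr (h1 hx)
  · exact Or.inl (h2 hx)

/-- The integral `∫ f h` of an integrable function against an element of `L^∞`. -/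
def weightedIntegral (f : G → ℝ) (h : LInftyFun μ) : ℝ := ∫ x, f x * h.1 x ∂μ

theorem integrable_mul_LInftyFun {f : G → ℝ} (hf : Integrable f μ) (h : LInftyFun μ) :
    Integrable (fun x => f x * h.1 x) μ := by
  obtain ⟨C, hC⟩ := h.2.2
  exact integrable_smul_of_locally_bounded hf
    (fun K hK => (h.2.1 K hK).aestronglyMeasurable) hC

theorem weightedIntegral_add {f : G → ℝ} (hf : Integrable f μ) (h k : LInftyFun μ) :
    weightedIntegral f (h + k) = weightedIntegral f h + weightedIntegral f k := by
  rw [weightedIntegral, weightedIntegral, weightedIntegral,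
    ← integral_add (integrable_mul_LInftyFun hf h) (integrable_mul_LInftyFun hf k)]
  refine integral_congr_ae (ae_of_all _ fun x => ?_)
  exact mul_add (f x) (h.1 x) (k.1 x)

theorem weightedIntegral_smul (f : G → ℝ) (c : ℝ) (h : LInftyFun μ) :
    weightedIntegral f (c • h) = c * weightedIntegral f h := by
  rw [weightedIntegral, weightedIntegral, ← integral_const_mul]
  refine integral_congr_ae (ae_of_all _ fun x => ?_)
  exact mul_left_comm (f x) c (h.1 x)

theorem weightedIntegral_sub_left {f g : G → ℝ} (hf : Integrable f μ) (hg : Integrable g μ)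
    (h : LInftyFun μ) :
    weightedIntegral f h - weightedIntegral g h = weightedIntegral (fun x => f x - g x) h := by
  rw [weightedIntegral, weightedIntegral, weightedIntegral,
    ← integral_sub (integrable_mul_LInftyFun hf h) (integrable_mul_LInftyFun hg h)]
  simp_rw [sub_mul]

theorem weightedIntegral_nonneg {f : G → ℝ} (hf : Integrable f μ) (hf0 : ∀ x, 0 ≤ f x)
    {h : LInftyFun μ} (hh : ∀ K : Set G, IsCompact K → ∀ᵐ x ∂(μ.restrict K), 0 ≤ h.1 x) :
    0 ≤ weightedIntegral f h := by
  refine integral_nonneg_of_ae ?_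
  filter_upwards [ae_eq_zero_or_of_locally_ae hf hh] with x hx
  rcases hx with hx | hx
  · simp [hx]
  · exact mul_nonneg (hf0 x) hx

theorem abs_weightedIntegral_le {f : G → ℝ} (hf : Integrable f μ) {h : LInftyFun μ} {C : ℝ}
    (hC : ∀ K : Set G, IsCompact K → ∀ᵐ x ∂(μ.restrict K), |h.1 x| ≤ C) :
    |weightedIntegral f h| ≤ (∫ x, |f x| ∂μ) * C := by
  rw [← integral_mul_const]
  change ‖∫ x, f x * h.1 x ∂μ‖ ≤ _
  refine norm_integral_le_of_norm_le (hf.abs.mul_const C) ?_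
  filter_upwards [ae_eq_zero_or_of_locally_ae hf hC] with x hx
  rw [Real.norm_eq_abs, abs_mul]
  rcases hx with hx | hx
  · simp [hx]
  · exact mul_le_mul_of_nonneg_left hx (abs_nonneg _)

end Pairing

variable {G : Type*} [Group G] [TopologicalSpace G] [IsTopologicalGroup G]
  [MeasurableSpace G] [BorelSpace G] [LocallyCompactSpace G] [T2Space G]
  {μ : Measure G} [μ.IsHaarMeasure] [μ.Regular]

theorem weightedIntegral_translate (f : Lp ℂ 1 μ) (x : G) (h : LInftyFun μ) :
    weightedIntegral (fun y => ‖f y‖) (LInftyFun.translate x h) =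
      weightedIntegral (fun y => ‖leftTranslate x⁻¹ f y‖) h := by
  rw [weightedIntegral, weightedIntegral, ← integral_mul_left_eq_self _ x]
  refine integral_congr_ae ?_
  filter_upwards [coeFn_leftTranslate x⁻¹ f] with y hy
  change ‖f (x * y)‖ * h.1 (x⁻¹ * (x * y)) = _
  rw [hy, inv_inv, inv_mul_cancel_left]

/-- A group with a net of nonvanishing asymptotically left invariant functions in `L¹(G)` is
amenable. -/
theorem isAmenableGroup_of_tendsto {Λ : Type*} {l : Filter Λ} [l.NeBot] {f : Λ → Lp ℂ 1 μ}
    {c : ℝ} (hc : 0 < c) (hfc : ∀ᶠ i in l, c ≤ ‖f i‖)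
    (hf : ∀ x : G, Tendsto (fun i => leftTranslate x (f i) - f i) l (𝓝 0)) :
    IsAmenableGroup G μ := by
  let U : Ultrafilter Λ := Ultrafilter.of l
  have hU : (U : Filter Λ) ≤ l := Ultrafilter.of_le l
  have hInt : ∀ i, Integrable (fun x => ‖f i x‖) μ := fun i => (L1.integrable_coeFn (f i)).norm
  -- The `f i` are complex-valued, so their absolute values serve as densities. This preserves
  -- asymptotic invariance because `||a| - |b|| ≤ |a - b|`.
  let M : Λ → LInftyFun μ → ℝ := fun i h => weightedIntegral (fun x => ‖f i x‖) h / ‖f i‖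
  have hbound : ∀ h : LInftyFun μ, ∃ C, ∀ i, M i h ∈ Set.Icc (-C) C := by
    intro h
    obtain ⟨C, hC⟩ := h.2.2
    refine ⟨|C|, fun i => abs_le.1 ?_⟩
    have h1 := abs_weightedIntegral_le (hInt i) hC
    simp only [abs_norm] at h1
    rw [← L1.norm_eq_integral_norm] at h1
    rw [abs_div, abs_norm]
    refine div_le_of_le_mul₀ (norm_nonneg _) (abs_nonneg _) (h1.trans ?_)
    rw [mul_comm]
    exact mul_le_mul_of_nonneg_right (le_abs_self C) (norm_nonneg _)
  -- Along an ultrafilter every bounded family converges, and uniqueness of limits then carries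
  -- linearity, positivity and invariance over to the limit.
  have hlim : ∀ h : LInftyFun μ, ∃ r, Tendsto (fun i => M i h) U (𝓝 r) := by
    intro h
    obtain ⟨C, hC⟩ := hbound h
    obtain ⟨r, -, hr⟩ := (isCompact_Icc (a := -C) (b := C)).ultrafilter_le_nhds
      (U.map fun i => M i h) (by
        rw [le_principal_iff]
        exact Filter.mem_map.2 (Filter.univ_mem' hC))
    exact ⟨r, hr⟩
  choose m hm using hlim
  refine ⟨{ toFun := m, map_add' := fun h k => ?_, map_smul' := fun r h => ?_ }, ?_, fun h hh => ?_,
    fun x h => ?_⟩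
  · refine tendsto_nhds_unique (hm (h + k)) (((hm h).add (hm k)).congr fun i => ?_)
    simp only [M]
    rw [weightedIntegral_add (hInt i), add_div]
  · refine tendsto_nhds_unique (hm (r • h)) (((hm h).const_mul r).congr fun i => ?_)
    simp only [M]
    rw [weightedIntegral_smul, mul_div_assoc]
  · refine tendsto_nhds_unique (hm (LInftyFun.one μ)) (tendsto_const_nhds.congr' ?_)
    filter_upwards [hU hfc] with i hi
    have h1 : weightedIntegral (fun x => ‖f i x‖) (LInftyFun.one μ) = ‖f i‖ := by
      rw [L1.norm_eq_integral_norm]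
      exact integral_congr_ae (ae_of_all _ fun x => mul_one _)
    simp only [M]
    rw [h1, div_self (hc.trans_le hi).ne']
  · exact ge_of_tendsto' (hm h) fun i =>
      div_nonneg (weightedIntegral_nonneg (hInt i) (fun x => norm_nonneg _) hh) (norm_nonneg _)
  · change m (LInftyFun.translate x h) = m h
    rw [← sub_eq_zero]
    refine tendsto_nhds_unique ((hm (LInftyFun.translate x h)).sub (hm h)) ?_
    obtain ⟨C, hC⟩ := h.2.2
    -- The lower bound `c` on the norms keeps the normalization from spoiling the convergence.
    have h0 : Tendsto (fun i => ‖leftTranslate x⁻¹ (f i) - f i‖ * |C| / c) U (𝓝 0) := by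
      have := (((hf x⁻¹).norm.mul_const |C|).div_const c).mono_left hU
      simpa using this
    refine squeeze_zero_norm' ?_ h0
    filter_upwards [hU hfc] with i hi
    simp only [M]
    rw [← sub_div, norm_div, norm_norm, weightedIntegral_translate,
      weightedIntegral_sub_left (L1.integrable_coeFn _).norm (hInt i)]
    refine div_le_div₀ (by positivity) ?_ hc hi
    have h1 := abs_weightedIntegral_le (((L1.integrable_coeFn (leftTranslate x⁻¹ (f i))).norm).sub
      (hInt i)) hC
    refine (h1.trans (mul_le_mul_of_nonneg_left (le_abs_self C)
      (integral_nonneg fun y => abs_nonneg _))).trans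
      (mul_le_mul_of_nonneg_right ?_ (abs_nonneg C))
    rw [L1.norm_eq_integral_norm]
    refine integral_mono_ae ((L1.integrable_coeFn _).norm.sub (hInt i)).abs
      (L1.integrable_coeFn _).norm ?_
    filter_upwards [Lp.coeFn_sub (leftTranslate x⁻¹ (f i)) (f i)] with y hy
    rw [hy]
    exact abs_norm_sub_norm_le _ _

namespace GroupL1

open ProjTensorSq

/-- Slicing by the augmentation turns the approximate diagonal into a net in `L¹(G)` on which `a`
acts asymptotically as the scalar `χ(a)`. -/
theorem isAmenableGroup_of_isApproximateDiagonal {Λ : Type*} [Preorder Λ] [Nonempty Λ]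
    [IsDirected Λ (· ≤ ·)] {t : Λ → ProjTensorSq (GroupL1 G μ)} (ht : IsApproximateDiagonal t) :
    IsAmenableGroup G μ := by
  obtain ⟨e, -, he, -⟩ : ∃ e : GroupL1 G μ, ‖e‖ ≤ 1 ∧ aug μ e = 1 ∧
      ∀ a ∈ (∅ : Finset (GroupL1 G μ)), ‖e * a - a‖ < 1 :=
    exists_left_approximate_unit (μ := μ) _ one_pos
  let f : Λ → GroupL1 G μ := fun i => slice (aug μ) (t i)
  have hmul : ∀ a, Tendsto (fun i => a * f i - aug μ a • f i) atTop (𝓝 0) := by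
    intro a
    have h := ((slice (aug μ)).continuous.tendsto 0).comp (ht a).1
    rw [map_zero] at h
    refine h.congr fun i => ?_
    simp only [Function.comp_apply]
    rw [map_sub, slice_leftMul, slice_rightMul aug_mul]
  have haug : Tendsto (fun i => aug μ (f i)) atTop (𝓝 1) := by
    have h := ((aug μ).continuous.tendsto e).comp (ht e).2
    rw [he] at h
    refine h.congr fun i => ?_
    simp only [Function.comp_apply, f]
    rw [aug_mul, he, mul_one, apply_slice aug_mul]
  -- With `χ(e) = χ(L_x e) = 1`, write `L_x f - f = ((L_x e) * f - f) - L_x (e * f - f)`; both terms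
  -- tend to zero by `hmul`.
  have hinv : ∀ x : G, Tendsto (fun i => left μ x (f i) - f i) atTop (𝓝 0) := by
    intro x
    have hx : aug μ (left μ x e) = 1 := (augmentation_leftTranslate (μ := μ) x e).trans he
    have h := (hmul (left μ x e)).sub (((left μ x).continuous.tendsto 0).comp (hmul e))
    rw [map_zero, sub_zero] at h
    refine h.congr fun i => ?_
    simp only [Function.comp_apply]
    rw [hx, he, one_smul, map_sub, left_apply_mul]
    abel
  have hnorm : ∀ᶠ i in atTop, (1 / 2 : ℝ) ≤ ‖f i‖ := by
    have h := haug.norm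
    rw [norm_one] at h
    filter_upwards [h.eventually_const_lt (show (1 / 2 : ℝ) < 1 by norm_num)] with i hi
    exact hi.le.trans (norm_augmentation_le (μ := μ) (f i))
  exact isAmenableGroup_of_tendsto (f := fun i => toLp (f i)) one_half_pos hnorm hinv

end GroupL1

end Mean

end

theorem mainTheorem5 {G : Type*} [Group G] [TopologicalSpace G] [IsTopologicalGroup G]
    [LocallyCompactSpace G] [T2Space G] [MeasurableSpace G] [BorelSpace G]
    (μ : MeasureTheory.Measure G) [μ.IsHaarMeasure] [μ.Regular] :
    IsSymmetricallyPseudoAmenable (GroupL1 G μ) ↔ IsAmenableGroup G μ := by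
  refine ⟨?_, GroupL1.isSymmetricallyPseudoAmenable_of_isAmenableGroup⟩
  rintro ⟨Λ, _, _, _, t, ht, -⟩
  exact GroupL1.isAmenableGroup_of_isApproximateDiagonal ht
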